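/- **Proposition 3.1.** For a number field $K$ with ring of integers $\mathcal O$, a nonzero prime ideal $\mathcal P$ of $\mathcal O$ and an integer $n\ge 1$, put $R=\mathcal O/\mathcal P^n$, $q=|R|$, and write $|\mathcal O/\mathcal P|=p^{d_0}$ with $p$ prime. Let $\pi_m:R\to\mathcal O/\mathcal P^m$ $(m\le n)$ be the projection, and let $\mathfrak p\in R$ be the class of an element of $\mathcal P\setminus\mathcal P^2$. For a probability measure $\mu$ on $R$ and an additive character $\xi\in\hat R$ put $\hat\mu(\xi)=\sum_{x\in R}\mu(x)\xi(x)$, $(y\xi)(x)=\xi(xy)$, $\mu_-(x)=\mu(-x)$, $(\mu*\nu)(x)=\sum_{y+z=x}\mu(y)\nu(z)$ and $\phi=q(\mu*\mu_-)$. Given $C,c,\epsilon,\tau>0$, consider the following three alternatives. (i) $\displaystyle\sum_{y\in R}\sum_{\xi\in\hat R}|\hat\mu(\xi)|^2|\hat\mu(y\xi)|^2\mu(y)<q^{-\tau}\sum_{\xi\in\hat R}|\hat\mu(\xi)|^2 .$ (ii) There is an integer $m$ with $\epsilon n<m\le n$ and $\displaystyle\max_{y\in\mathcal O/\mathcal P^m}\mu(\pi_m^{-1}(y))>c\,p^{-2d_0m\tau/\epsilon}.$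 (iii) There are a set $\bar S\subset R^*$ of units and an integer $0\le m'<2\epsilon n$ such that $$|\bar S|\sum_{\xi\in\hat R}|\hat\mu(\xi)|^2<q^{1+2\epsilon},\qquad |\bar S+\bar S|+|\bar S\cdot\bar S|<q^{C\epsilon}|\bar S|,\qquad |\mathfrak p^{m'}\bar S|=|\bar S|,$$ $$\phi(x)>q^{-2\epsilon}\phi(0)\ \text{ for all }x\in\mathfrak p^{m'}\bar S,\qquad (\mu*\mu_-)(\mathfrak p^{m'}\bar S)>q^{-C\epsilon}.$$ There are absolute constants $C>0$ and $\epsilon_0>0$ such that for all real $0<\tau<\epsilon<\epsilon_0$: (a) there is a constant $c>0$, depending only on $\epsilon$ and $\tau$, such that for all $K,\mathcal P,n,\mathfrak p,\mu$ as above at least one of (i), (ii), (iii) holds; (b) for every $c>0$ there is $N$, depending only on $\epsilon,\tau,c$, such that for all $K,\mathcal P,n,\mathfrak p,\mu$ as above with $q\ge N$ at least one of (i), (ii), (iii) holds. -/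

import Mathlib

open NumberField IsDedekindDomain
open scoped Pointwise

universe u

namespace SumProduct

noncomputable section

/-- The residue rings `𝓞 K ⧸ P ^ n` of a nonzero prime `P` are finite. -/
instance fintypeResidueRing (K : Type*) [Field K] [NumberField K]
    (P : HeightOneSpectrum (𝓞 K)) (n : ℕ) : Fintype (𝓞 K ⧸ P.asIdeal ^ n) :=
  haveI : Finite (𝓞 K ⧸ P.asIdeal ^ n) :=
    Ideal.finiteQuotientOfFreeOfNeBot _ (pow_ne_zero n P.ne_bot)
  Fintype.ofFinite _

/-- A probability measure on a finite set, given by its point masses. -/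
def IsProbability {R : Type*} [Fintype R] (μ : R → ℝ) : Prop :=
  (∀ x, 0 ≤ μ x) ∧ ∑ x, μ x = 1

/-- The mass of a set of points. -/
def mass {R : Type*} (μ : R → ℝ) (A : Finset R) : ℝ :=
  ∑ x ∈ A, μ x

/-- The Fourier transform of `μ` at the additive character `ξ`. -/
def fourier {R : Type*} [CommRing R] [Fintype R] (μ : R → ℝ) (ξ : AddChar R ℂ) : ℂ :=
  ∑ x, (μ x : ℂ) * ξ x

open Classical in
/-- Additive convolution. -/
def addConv {R : Type*} [CommRing R] [Fintype R] (μ ν : R → ℝ) (x : R) : ℝ :=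
  ∑ y, ∑ z, if y + z = x then μ y * ν z else 0

/-- The reflected measure `x ↦ μ (-x)`. -/
def reflect {R : Type*} [CommRing R] (μ : R → ℝ) (x : R) : ℝ :=
  μ (-x)

/-- `φ = q (μ * μ₋)`, where `q = |R|`. -/
def phi {R : Type*} [CommRing R] [Fintype R] (μ : R → ℝ) (x : R) : ℝ :=
  (Fintype.card R : ℝ) * addConv μ (reflect μ) x

/-- The squared `ℓ²` norm of the Fourier transform. -/
def fourierEnergy {R : Type*} [CommRing R] [Fintype R] (μ : R → ℝ) : ℝ :=
  ∑ ξ : AddChar R ℂ, ‖fourier μ ξ‖ ^ 2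

/-- First alternative. Here `ξ.mulShift y` is the character `x ↦ ξ (y * x)`. -/
def FourierDecay {R : Type*} [CommRing R] [Fintype R] (τ : ℝ) (μ : R → ℝ) : Prop :=
  ∑ y : R, ∑ ξ : AddChar R ℂ, ‖fourier μ ξ‖ ^ 2 * ‖fourier μ (ξ.mulShift y)‖ ^ 2 * μ y
    < (Fintype.card R : ℝ) ^ (-τ) * fourierEnergy μ

open Classical in
/-- Second alternative: for some `m` with `ε n < m ≤ n`, some fibre of the projection
`𝓞 K ⧸ P ^ n → 𝓞 K ⧸ P ^ m` has mass larger than `c p ^ (- 2 d₀ m τ / ε)`. -/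
def Concentrated {K : Type*} [Field K] [NumberField K] {P : HeightOneSpectrum (𝓞 K)} {n : ℕ}
    (c ε τ : ℝ) (p d₀ : ℕ) (μ : 𝓞 K ⧸ P.asIdeal ^ n → ℝ) : Prop :=
  ∃ (m : ℕ) (hm : m ≤ n), ε * n < m ∧ ∃ y : 𝓞 K ⧸ P.asIdeal ^ m,
    c * (p : ℝ) ^ (-(2 * d₀ * m * τ / ε)) <
      mass μ {x | Ideal.Quotient.factorPow P.asIdeal hm x = y}

open Classical in
/-- Third alternative, in a finite ring `R` (to be used for `R = 𝓞 K ⧸ P ^ n`) with a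
distinguished element `ϖ` (the class of a uniformizer). -/
def HasSumProductSet {R : Type*} [CommRing R] [Fintype R]
    (C ε : ℝ) (n : ℕ) (ϖ : R) (μ : R → ℝ) : Prop :=
  ∃ S : Finset R, (∀ x ∈ S, IsUnit x) ∧
    S.card * fourierEnergy μ < (Fintype.card R : ℝ) ^ (1 + 2 * ε) ∧
    ((S + S).card : ℝ) + (S * S).card < (Fintype.card R : ℝ) ^ (C * ε) * S.card ∧
    ∃ m' : ℕ, (m' : ℝ) < 2 * ε * n ∧
      (S.image (ϖ ^ m' * ·)).card = S.card ∧
      (∀ x ∈ S.image (ϖ ^ m' * ·), (Fintype.card R : ℝ) ^ (-(2 * ε)) * phi μ 0 < phi μ x) ∧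
      (Fintype.card R : ℝ) ^ (-(C * ε)) <
        mass (addConv μ (reflect μ)) (S.image (ϖ ^ m' * ·))

/-- At least one of the three alternatives holds, for every number field, every power `P ^ n`
(`n ≥ 1`) of a nonzero prime with `|𝓞 K ⧸ P ^ n| ≥ N`, every uniformizer `ϖ` at `P` and every
probability measure on `𝓞 K ⧸ P ^ n`. -/
def TrichotomyFrom (C c ε τ : ℝ) (N : ℕ) : Prop :=
  ∀ (K : Type u) [Field K] [NumberField K] (P : HeightOneSpectrum (𝓞 K)) (n p d₀ : ℕ)
    (ϖ : 𝓞 K) (μ : 𝓞 K ⧸ P.asIdeal ^ n → ℝ),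
    1 ≤ n → p.Prime → Nat.card (𝓞 K ⧸ P.asIdeal) = p ^ d₀ →
    N ≤ Fintype.card (𝓞 K ⧸ P.asIdeal ^ n) →
    ϖ ∈ P.asIdeal → ϖ ∉ P.asIdeal ^ 2 → IsProbability μ →
    FourierDecay τ μ ∨ Concentrated c ε τ p d₀ μ ∨
      HasSumProductSet C ε n (Ideal.Quotient.mk (P.asIdeal ^ n) ϖ) μ

end

end SumProduct

namespace SumProduct

/-- If the sets `A'`, `M` satisfy a lower bound on common neighbourhoods, then
`A' / A'` is small: each quotient has many representations `c₁ / c₂ * (c₃ / c₄)`. -/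
@[to_additive]
theorem card_div_mul_le_of_codegree {G : Type*} [CommGroup G] [DecidableEq G]
    (A' N B C : Finset G) (s t : ℝ) (ht : 0 ≤ t)
    (hs : ∀ a ∈ A', ∀ a' ∈ A', s ≤ (N.filter fun x =>
      t ≤ (B.filter fun b => a * b ∈ C ∧ x * b ∈ C).card ∧
      t ≤ (B.filter fun b => x * b ∈ C ∧ a' * b ∈ C).card).card) :
    ((A' / A').card : ℝ) * (s * t ^ 2) ≤ (C.card : ℝ) ^ 4 := by
  set f : G × G × G × G → G := fun c => c.1 / c.2.1 * (c.2.2.1 / c.2.2.2) with hf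
  have key : ∀ d ∈ A' / A', s * t ^ 2 ≤
      (((C ×ˢ C ×ˢ C ×ˢ C).filter fun c => f c = d).card : ℝ) := by
    intro d hd
    obtain ⟨a, ha, a', ha', rfl⟩ := Finset.mem_div.1 hd
    set M := N.filter fun x =>
      t ≤ (B.filter fun b => a * b ∈ C ∧ x * b ∈ C).card ∧
      t ≤ (B.filter fun b => x * b ∈ C ∧ a' * b ∈ C).card with hM
    set Z : Finset (Σ _ : G, G × G) := M.sigma fun x =>
      (B.filter fun b => a * b ∈ C ∧ x * b ∈ C) ×ˢ (B.filter fun b => x * b ∈ C ∧ a' * b ∈ C)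
      with hZ
    have h1 : s * t ^ 2 ≤ (Z.card : ℝ) := by
      rw [hZ, Finset.card_sigma]
      push_cast [Finset.card_product]
      calc s * t ^ 2 ≤ M.card * t ^ 2 := by gcongr; exact hs a ha a' ha'
        _ = ∑ x ∈ M, t * t := by rw [Finset.sum_const, nsmul_eq_mul, sq]
        _ ≤ _ := by
          refine Finset.sum_le_sum fun x hx => ?_
          have := (Finset.mem_filter.1 hx).2
          exact mul_le_mul this.1 this.2 ht (by positivity)
    refine h1.trans ?_
    norm_cast
    refine Finset.card_le_card_of_injOn
      (fun z => (a * z.2.1, z.1 * z.2.1, z.1 * z.2.2, a' * z.2.2)) ?_ ?_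
    · rintro ⟨x, b, b'⟩ hz
      simp only [hZ, Finset.coe_sigma, Set.mem_sigma_iff, Finset.mem_coe, Finset.mem_product,
        Finset.mem_filter] at hz
      simp only [Finset.mem_coe, Finset.mem_filter, Finset.mem_product, hf]
      refine ⟨⟨hz.2.1.2.1, hz.2.1.2.2, hz.2.2.2.1, hz.2.2.2.2⟩, ?_⟩
      rw [mul_div_mul_right_eq_div, mul_div_mul_right_eq_div, div_mul_div_cancel]
    · rintro ⟨x, b, b'⟩ - ⟨y, e, e'⟩ - h
      simp only [Prod.mk.injEq, mul_right_inj] at h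
      obtain ⟨rfl, h2, h3, h4⟩ := h
      rw [mul_left_inj] at h2
      subst h2 h4
      rfl
  calc ((A' / A').card : ℝ) * (s * t ^ 2) = ∑ d ∈ A' / A', s * t ^ 2 := by
        rw [Finset.sum_const, nsmul_eq_mul]
    _ ≤ ∑ d ∈ A' / A', (((C ×ˢ C ×ˢ C ×ˢ C).filter fun c => f c = d).card : ℝ) :=
        Finset.sum_le_sum key
    _ ≤ ((C ×ˢ C ×ˢ C ×ˢ C).card : ℝ) := by
        norm_cast
        rw [← Finset.card_biUnion]
        · exact Finset.card_le_card (Finset.biUnion_subset.2 fun _ _ => Finset.filter_subset _ _)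
        · intro d _ d' _ hdd
          exact Finset.disjoint_filter.2 fun c _ h h' => hdd (h.symm.trans h')
    _ = (C.card : ℝ) ^ 4 := by push_cast [Finset.card_product]; ring

/-- Dependent random choice: a dense relation `r` on `A × B` has a vertex `b` whose
neighbourhood has few pairs with few common neighbours. -/
theorem exists_neighbourhood_few_bad {α β : Type*} [DecidableEq α]
    (A : Finset α) (B : Finset β) (r : α → β → Prop) [∀ a b, Decidable (r a b)] (L H : ℝ)
    (hL : 0 < L) (hH : 0 < H) (hA : (A.card : ℝ) ≤ H * L) (hB : (B.card : ℝ) ≤ H * L)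
    (hE : L ^ 2 / H ≤ ∑ b ∈ B, ((A.filter fun a => r a b).card : ℝ)) :
    ∃ N ⊆ A, L ^ 2 / (2 * H ^ 4) + 8 * ((N ×ˢ N).filter fun x =>
        ((B.filter fun b => r x.1 b ∧ r x.2 b).card : ℝ) < L / (16 * H ^ 5)).card
      ≤ (N.card : ℝ) ^ 2 := by
  set t := L / (16 * H ^ 5) with ht
  set N : β → Finset α := fun b => A.filter fun a => r a b with hN
  set e := ∑ b ∈ B, ((N b).card : ℝ) with he
  set bad : β → Finset (α × α) := fun b => (N b ×ˢ N b).filter fun x =>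
        ((B.filter fun b => r x.1 b ∧ r x.2 b).card : ℝ) < t with hbad
  have hsq : e ^ 2 ≤ B.card * ∑ b ∈ B, ((N b).card : ℝ) ^ 2 := sq_sum_le_card_mul_sum_sq
  have hbadsum : ∑ b ∈ B, ((bad b).card : ℝ) ≤ t * (A.card : ℝ) ^ 2 := by
    have : ∀ b, bad b = ((A ×ˢ A).filter fun x =>
        ((B.filter fun b => r x.1 b ∧ r x.2 b).card : ℝ) < t).filter
          fun x => r x.1 b ∧ r x.2 b := by
      intro b; ext x
      simp only [hbad, hN, Finset.mem_filter, Finset.mem_product]; tauto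
    calc ∑ b ∈ B, ((bad b).card : ℝ)
        = ∑ x ∈ (A ×ˢ A).filter fun x =>
            ((B.filter fun b => r x.1 b ∧ r x.2 b).card : ℝ) < t,
            ((B.filter fun b => r x.1 b ∧ r x.2 b).card : ℝ) := by
          simp_rw [this]
          exact_mod_cast Finset.sum_card_bipartiteAbove_eq_sum_card_bipartiteBelow
            fun b (x : α × α) => r x.1 b ∧ r x.2 b
      _ ≤ ∑ x ∈ (A ×ˢ A).filter fun x =>
            ((B.filter fun b => r x.1 b ∧ r x.2 b).card : ℝ) < t, t :=
          Finset.sum_le_sum fun x hx => (Finset.mem_filter.1 hx).2.le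
      _ ≤ ∑ x ∈ A ×ˢ A, t := by
          refine Finset.sum_le_sum_of_subset_of_nonneg (Finset.filter_subset _ _) ?_
          intros; positivity
      _ = t * (A.card : ℝ) ^ 2 := by
          rw [Finset.sum_const, nsmul_eq_mul]; push_cast [Finset.card_product]; ring
  by_contra! hcon
  have hlt : ∀ b ∈ B, ((N b).card : ℝ) ^ 2 < L ^ 2 / (2 * H ^ 4) + 8 * ((bad b).card : ℝ) :=
    fun b _ => hcon (N b) (Finset.filter_subset _ _)
  have hBne : B.Nonempty := by
    rw [Finset.nonempty_iff_ne_empty]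
    rintro rfl
    have : 0 < L ^ 2 / H := by positivity
    rw [he, Finset.sum_empty] at hE
    linarith
  have hBpos : (0 : ℝ) < B.card := by exact_mod_cast hBne.card_pos
  have hsum : ∑ b ∈ B, ((N b).card : ℝ) ^ 2
      < B.card * (L ^ 2 / (2 * H ^ 4)) + 8 * ∑ b ∈ B, ((bad b).card : ℝ) := by
    refine (Finset.sum_lt_sum_of_nonempty hBne hlt).trans_eq ?_
    rw [Finset.sum_add_distrib, ← Finset.mul_sum, Finset.sum_const, nsmul_eq_mul]
  have h1 : e ^ 2 < (H * L) * (H * L * (L ^ 2 / (2 * H ^ 4)) + 8 * (t * (H * L) ^ 2)) := by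
    calc e ^ 2 ≤ _ := hsq
      _ < B.card * (B.card * (L ^ 2 / (2 * H ^ 4)) + 8 * ∑ b ∈ B, ((bad b).card : ℝ)) := by
        gcongr
      _ ≤ B.card * (B.card * (L ^ 2 / (2 * H ^ 4)) + 8 * (t * (A.card : ℝ) ^ 2)) := by gcongr
      _ ≤ _ := by gcongr
  have h2 : (L ^ 2 / H) ^ 2 ≤ e ^ 2 := by gcongr
  have h3 : (H * L) * (H * L * (L ^ 2 / (2 * H ^ 4)) + 8 * (t * (H * L) ^ 2))
      = (L ^ 2 / H) ^ 2 := by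
    rw [ht]; field_simp; ring
  linarith

/-- The **Balog–Szemerédi–Gowers theorem** for a dense set of pairs with few products. -/
@[to_additive]
theorem exists_subset_card_div_le {G : Type*} [CommGroup G] [DecidableEq G]
    (A B C : Finset G) (L H : ℝ) (hL : 0 < L) (hH : 0 < H)
    (hA : (A.card : ℝ) ≤ H * L) (hB : (B.card : ℝ) ≤ H * L) (hC : (C.card : ℝ) ≤ H * L)
    (hE : L ^ 2 / H ≤ (((A ×ˢ B).filter fun x => x.1 * x.2 ∈ C).card : ℝ)) :
    ∃ A' ⊆ A, L / (4 * H ^ 2) ≤ (A'.card : ℝ) ∧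
      ((A' / A').card : ℝ) ≤ 1024 * H ^ 16 * L := by
  obtain ⟨N, hNA, hN⟩ := exists_neighbourhood_few_bad A B (fun a b => a * b ∈ C) L H hL hH hA hB
    (by
      refine hE.trans_eq ?_
      rw [Finset.card_filter, Finset.sum_product_right]
      push_cast
      exact Finset.sum_congr rfl fun b _ => by rw [Finset.card_filter]; push_cast; rfl)
  set t := L / (16 * H ^ 5) with ht
  have ht0 : 0 < t := by positivity
  set bad := (N ×ˢ N).filter fun x =>
    ((B.filter fun b => x.1 * b ∈ C ∧ x.2 * b ∈ C).card : ℝ) < t with hbad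
  set nb : G → Finset G := fun a => N.filter fun x =>
    ((B.filter fun b => a * b ∈ C ∧ x * b ∈ C).card : ℝ) < t with hnb
  have hbadsum : (bad.card : ℝ) = ∑ a ∈ N, ((nb a).card : ℝ) := by
    rw [hbad]
    rw [Finset.card_filter, Finset.sum_product]
    push_cast
    exact Finset.sum_congr rfl fun b _ => by rw [hnb, Finset.card_filter]; push_cast; rfl
  have hNpos : L / (2 * H ^ 2) ≤ (N.card : ℝ) := by
    refine le_of_sq_le_sq ?_ (by positivity)
    have h0 : (0 : ℝ) ≤ bad.card := by positivity
    calc (L / (2 * H ^ 2)) ^ 2 = L ^ 2 / (2 * H ^ 4) / 2 := by field_simp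
      _ ≤ L ^ 2 / (2 * H ^ 4) := half_le_self (by positivity)
      _ ≤ _ := by linarith
  have hNpos' : (0 : ℝ) < N.card := lt_of_lt_of_le (by positivity) hNpos
  set A' := N.filter fun a => ((nb a).card : ℝ) ≤ N.card / 4 with hA'
  have hA'card : (N.card : ℝ) / 2 ≤ A'.card := by
    have h1 : (N.card : ℝ) = A'.card + (N.filter fun a => ¬ ((nb a).card : ℝ) ≤ N.card / 4).card := by
      norm_cast
      rw [hA', Finset.card_filter_add_card_filter_not]
    have h2 : ((N.filter fun a => ¬ ((nb a).card : ℝ) ≤ N.card / 4).card : ℝ) * (N.card / 4)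
        ≤ bad.card := by
      rw [hbadsum, ← nsmul_eq_mul, ← Finset.sum_const]
      refine (Finset.sum_le_sum fun a ha => ?_).trans
        (Finset.sum_le_sum_of_subset_of_nonneg (Finset.filter_subset _ _)
          fun _ _ _ => Nat.cast_nonneg _)
      exact (not_le.1 (Finset.mem_filter.1 ha).2).le
    have h3 : 8 * (bad.card : ℝ) ≤ (N.card : ℝ) ^ 2 :=
      le_trans (le_add_of_nonneg_left (by positivity)) hN
    have h4 : ((N.filter fun a => ¬ ((nb a).card : ℝ) ≤ N.card / 4).card : ℝ) ≤ N.card / 2 := by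
      refine le_of_mul_le_mul_right ?_ (div_pos hNpos' four_pos)
      nlinarith
    linarith
  have hsym : ∀ a x : G, (B.filter fun b => x * b ∈ C ∧ a * b ∈ C)
      = B.filter fun b => a * b ∈ C ∧ x * b ∈ C := fun a x => by simp only [and_comm]
  have hpath := card_div_mul_le_of_codegree A' N B C (N.card / 2) t ht0.le (by
    intro a ha a' ha'
    set M := N.filter fun x =>
      t ≤ (B.filter fun b => a * b ∈ C ∧ x * b ∈ C).card ∧
      t ≤ (B.filter fun b => x * b ∈ C ∧ a' * b ∈ C).card with hM
    have hsub : N ⊆ M ∪ (nb a ∪ nb a') := by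
      intro x hx
      by_contra hcon
      simp only [Finset.mem_union, not_or, hnb, hM, Finset.mem_filter, hx, true_and, not_lt] at hcon
      rw [hsym a' x] at hcon
      exact hcon.1 hcon.2
    have h1 : (N.card : ℝ) ≤ M.card + ((nb a).card + (nb a').card) := by
      norm_cast
      exact (Finset.card_le_card hsub).trans ((Finset.card_union_le _ _).trans
        (Nat.add_le_add_left (Finset.card_union_le _ _) _))
    have h2 := (Finset.mem_filter.1 ha).2
    have h3 := (Finset.mem_filter.1 ha').2
    linarith)
  refine ⟨A', (Finset.filter_subset _ _).trans hNA, ?_, ?_⟩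
  · refine le_trans ?_ hA'card
    calc L / (4 * H ^ 2) = L / (2 * H ^ 2) / 2 := by field_simp; norm_num
      _ ≤ _ := by gcongr
  · have h1 : ((A' / A').card : ℝ) * (L / (2 * H ^ 2) / 2 * t ^ 2) ≤ (H * L) ^ 4 := by
      calc _ ≤ ((A' / A').card : ℝ) * (N.card / 2 * t ^ 2) := by gcongr
        _ ≤ _ := hpath
        _ ≤ _ := by gcongr
    have h2 : 1024 * H ^ 16 * L * (L / (2 * H ^ 2) / 2 * t ^ 2) = (H * L) ^ 4 := by
      rw [ht]; field_simp; norm_num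
    refine le_of_mul_le_mul_right (h1.trans_eq h2.symm) (by positivity)

/-- The Balog–Szemerédi–Gowers theorem combined with Plünnecke's inequality. -/
@[to_additive]
theorem exists_subset_card_mul_self_le {G : Type*} [CommGroup G] [DecidableEq G]
    (A B C : Finset G) (L H : ℝ) (hL : 0 < L) (hH : 0 < H)
    (hA : (A.card : ℝ) ≤ H * L) (hB : (B.card : ℝ) ≤ H * L) (hC : (C.card : ℝ) ≤ H * L)
    (hE : L ^ 2 / H ≤ (((A ×ˢ B).filter fun x => x.1 * x.2 ∈ C).card : ℝ)) :
    ∃ A' ⊆ A, L / (4 * H ^ 2) ≤ (A'.card : ℝ) ∧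
      ((A' * A').card : ℝ) ≤ (4096 * H ^ 18) ^ 2 * A'.card := by
  obtain ⟨A', hsub, hlow, hdiv⟩ := exists_subset_card_div_le A B C L H hL hH hA hB hC hE
  refine ⟨A', hsub, hlow, ?_⟩
  have hpos : (0 : ℝ) < A'.card := lt_of_lt_of_le (by positivity) hlow
  have hne : A'.Nonempty := Finset.card_pos.1 (by exact_mod_cast hpos)
  have h := Finset.pluennecke_ruzsa_inequality_pow_div_pow_div hne A' 2 0
  rw [pow_zero, div_one, pow_two, add_zero] at h
  have h' : ((A' * A').card : ℝ) ≤ ((A' / A').card / A'.card) ^ 2 * A'.card := by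
    have := (NNRat.cast_le (K := ℝ)).2 h
    push_cast at this
    exact this
  refine h'.trans ?_
  gcongr
  rw [div_le_iff₀ hpos]
  calc _ ≤ 1024 * H ^ 16 * L := hdiv
    _ = 4096 * H ^ 18 * (L / (4 * H ^ 2)) := by field_simp; norm_num
    _ ≤ _ := by gcongr

theorem IsProbability.mass_le_one {R : Type*} [Fintype R] {μ : R → ℝ} (hμ : IsProbability μ)
    (s : Finset R) : mass μ s ≤ 1 := by
  rw [← hμ.2]
  exact Finset.sum_le_sum_of_subset_of_nonneg (Finset.subset_univ _) fun x _ _ => hμ.1 x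

section Autocorrelation

variable {R : Type*} [CommRing R] [Fintype R]

/-- The autocorrelation `μ * μ₋`. -/
noncomputable abbrev autoConv (μ : R → ℝ) : R → ℝ := addConv μ (reflect μ)

theorem autoConv_apply (μ : R → ℝ) (x : R) : autoConv μ x = ∑ y, μ y * μ (y - x) := by
  classical
  unfold autoConv addConv reflect
  refine Finset.sum_congr rfl fun y _ => ?_
  rw [Finset.sum_eq_single (x - y)]
  · simp
  · intro z _ hz
    rw [if_neg]
    rintro rfl
    exact hz (by ring)
  · simp

theorem autoConv_zero (μ : R → ℝ) : autoConv μ 0 = ∑ y, μ y ^ 2 := by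
  simp [autoConv_apply, sq]

theorem sum_mul_apply_sub (μ : R → ℝ) (a b : R) :
    ∑ y, μ (y - a) * μ (y - b) = autoConv μ (b - a) := by
  rw [autoConv_apply]
  refine Fintype.sum_equiv (Equiv.subRight a) _ _ fun y => ?_
  rw [Equiv.subRight_apply]
  congr 2
  ring

theorem sum_mul_sum_eq_sum_autoConv (μ : R → ℝ) (f : R → ℝ) :
    ∑ y, ∑ z, μ y * μ z * f (y - z) = ∑ x, autoConv μ x * f x := by
  simp_rw [autoConv_apply, Finset.sum_mul]
  rw [Finset.sum_comm (s := Finset.univ (α := R)) (t := Finset.univ)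
    (f := fun x y => μ y * μ (y - x) * f x)]
  refine Finset.sum_congr rfl fun y _ => ?_
  refine Fintype.sum_equiv (Equiv.subLeft y) _ _ fun z => ?_
  simp

/-- The autocorrelation is positive definite; this is the Cauchy–Schwarz form of that. -/
theorem sq_sum_mul_autoConv_le {ι : Type*} (μ : R → ℝ) (s : Finset ι) (w : ι → ℝ) (z : ι → R) :
    (∑ i ∈ s, w i * autoConv μ (z i)) ^ 2 ≤
      autoConv μ 0 * ∑ i ∈ s, ∑ j ∈ s, w i * w j * autoConv μ (z i - z j) := by
  have h1 : ∑ i ∈ s, w i * autoConv μ (z i) = ∑ y, μ y * ∑ i ∈ s, w i * μ (y - z i) := by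
    simp_rw [autoConv_apply, Finset.mul_sum]
    rw [Finset.sum_comm]
    exact Finset.sum_congr rfl fun _ _ => Finset.sum_congr rfl fun _ _ => by ring
  have h2 : ∑ y, (∑ i ∈ s, w i * μ (y - z i)) ^ 2
      = ∑ i ∈ s, ∑ j ∈ s, w i * w j * autoConv μ (z i - z j) := by
    simp_rw [sq, Finset.sum_mul_sum]
    rw [Finset.sum_comm]
    refine Finset.sum_congr rfl fun i _ => ?_
    rw [Finset.sum_comm]
    refine Finset.sum_congr rfl fun j _ => ?_
    rw [← sum_mul_apply_sub, Finset.mul_sum]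
    exact Finset.sum_congr rfl fun _ _ => by ring
  rw [h1, ← h2, autoConv_zero]
  exact Finset.sum_mul_sq_le_sq_mul_sq _ _ _

variable {μ : R → ℝ}

theorem IsProbability.autoConv_nonneg (hμ : IsProbability μ) (x : R) : 0 ≤ autoConv μ x := by
  rw [autoConv_apply]
  exact Finset.sum_nonneg fun y _ => mul_nonneg (hμ.1 _) (hμ.1 _)

theorem IsProbability.autoConv_zero_pos (hμ : IsProbability μ) : 0 < autoConv μ 0 := by
  rw [autoConv_zero]
  refine lt_of_le_of_ne (Finset.sum_nonneg fun _ _ => sq_nonneg _) fun h => ?_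
  have h0 := (Finset.sum_eq_zero_iff_of_nonneg (fun y _ => sq_nonneg (μ y))).1 h.symm
  have : ∑ x, μ x = 0 := Finset.sum_eq_zero fun x hx => by simpa using h0 x hx
  linarith [hμ.2]

theorem IsProbability.autoConv_le (hμ : IsProbability μ) (x : R) : autoConv μ x ≤ autoConv μ 0 := by
  have h := sq_sum_mul_autoConv_le μ (Finset.univ : Finset Unit) (fun _ => 1) (fun _ => x)
  simp only [Finset.univ_unique, Finset.sum_singleton, one_mul, sub_self] at h
  exact le_of_sq_le_sq (h.trans_eq (sq _).symm) hμ.autoConv_zero_pos.le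

theorem IsProbability.sum_autoConv (hμ : IsProbability μ) : ∑ x, autoConv μ x = 1 := by
  have := sum_mul_sum_eq_sum_autoConv μ (fun _ => (1 : ℝ))
  simp only [mul_one, ← Finset.mul_sum, hμ.2] at this
  exact this.symm

theorem IsProbability.isProbability_autoConv (hμ : IsProbability μ) : IsProbability (autoConv μ) :=
  ⟨hμ.autoConv_nonneg, hμ.sum_autoConv⟩

/-- A level set of the autocorrelation is small. -/
theorem IsProbability.card_level_le (hμ : IsProbability μ) {θ : ℝ} (hθ : 0 < θ) (A : Finset R)
    (hA : ∀ x ∈ A, θ * autoConv μ 0 < autoConv μ x) :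
    (A.card : ℝ) ≤ θ⁻¹ * (autoConv μ 0)⁻¹ := by
  have h1 : (A.card : ℝ) * (θ * autoConv μ 0) ≤ 1 := by
    rw [← nsmul_eq_mul, ← Finset.sum_const]
    exact (Finset.sum_le_sum fun x hx => (hA x hx).le).trans
      (hμ.isProbability_autoConv.mass_le_one A)
  have := hμ.autoConv_zero_pos
  rw [← mul_inv, ← one_div, le_div_iff₀ (by positivity)]
  exact h1

/-- The mass that the autocorrelation gives to the kernel of a homomorphism is at most
the maximal mass of its fibres. -/
theorem IsProbability.mass_autoConv_ker_le (hμ : IsProbability μ) {S : Type*} [CommRing S] [DecidableEq S] (f : R →+* S)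
    {δ : ℝ} (h : ∀ y, mass μ (Finset.univ.filter fun x => f x = y) ≤ δ) :
    mass (autoConv μ) (Finset.univ.filter fun x => f x = 0) ≤ δ := by
  have h1 := sum_mul_sum_eq_sum_autoConv μ (fun x => if f x = 0 then (1 : ℝ) else 0)
  have h2 : mass (autoConv μ) (Finset.univ.filter fun x => f x = 0)
      = ∑ y, μ y * mass μ (Finset.univ.filter fun x => f x = f y) := by
    unfold mass
    rw [Finset.sum_filter]
    simp only [mul_ite, mul_one, mul_zero] at h1
    rw [← h1]
    refine Finset.sum_congr rfl fun y _ => ?_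
    rw [Finset.sum_filter, Finset.mul_sum]
    refine Finset.sum_congr rfl fun z _ => ?_
    simp only [map_sub, sub_eq_zero, eq_comm (a := f y), mul_ite, mul_zero]
  rw [h2]
  calc _ ≤ ∑ y, μ y * δ := by
        refine Finset.sum_le_sum fun y _ => ?_
        exact mul_le_mul_of_nonneg_left (h _) (hμ.1 _)
    _ = δ := by rw [← Finset.sum_mul, hμ.2, one_mul]

end Autocorrelation

section Fourier

variable {R : Type*} [CommRing R] [Fintype R]

theorem normSq_fourier (μ : R → ℝ) (ξ : AddChar R ℂ) :
    ((‖fourier μ ξ‖ ^ 2 : ℝ) : ℂ) = ∑ x, (autoConv μ x : ℂ) * ξ x := by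
  push_cast
  rw [← Complex.mul_conj', fourier, map_sum, Finset.sum_mul_sum]
  simp_rw [autoConv_apply]
  push_cast
  simp_rw [Finset.sum_mul]
  rw [Finset.sum_comm (s := Finset.univ (α := R)) (t := Finset.univ)
    (f := fun x y => (μ y : ℂ) * μ (y - x) * ξ x)]
  refine Finset.sum_congr rfl fun y _ => ?_
  refine Fintype.sum_equiv (Equiv.subLeft y) _ _ fun z => ?_
  rw [map_mul, Complex.conj_ofReal, ← AddChar.map_neg_eq_conj, Equiv.subLeft_apply, sub_sub_cancel,
    sub_eq_add_neg, AddChar.map_add_eq_mul]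
  ring

theorem autoConv_neg (μ : R → ℝ) (x : R) : autoConv μ (-x) = autoConv μ x := by
  have h := sum_mul_apply_sub μ x 0
  have h' := sum_mul_apply_sub μ 0 x
  rw [zero_sub] at h
  rw [sub_zero] at h'
  rw [← h, ← h']
  exact Finset.sum_congr rfl fun _ _ => mul_comm _ _

theorem sum_normSq_fourier_mul (μ : R → ℝ) (x : R) :
    ∑ ξ : AddChar R ℂ, ((‖fourier μ ξ‖ ^ 2 : ℝ) : ℂ) * ξ x = (phi μ x : ℂ) := by
  classical
  simp_rw [normSq_fourier, Finset.sum_mul]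
  rw [Finset.sum_comm]
  simp_rw [mul_assoc, ← AddChar.map_add_eq_mul, ← Finset.mul_sum, AddChar.sum_apply_eq_ite]
  rw [Finset.sum_eq_single (-x)]
  · rw [if_pos (by ring), autoConv_neg, phi]
    push_cast
    ring
  · intro y _ hy
    rw [if_neg, mul_zero]
    intro h
    exact hy (eq_neg_of_add_eq_zero_left h)
  · simp

theorem fourierEnergy_eq (μ : R → ℝ) : fourierEnergy μ = phi μ 0 := by
  have := sum_normSq_fourier_mul μ 0
  simp only [AddChar.map_zero_eq_one, mul_one] at this
  exact_mod_cast this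

theorem sum_normSq_fourier_mulShift (μ : R → ℝ) (y : R) :
    ∑ ξ : AddChar R ℂ, ‖fourier μ ξ‖ ^ 2 * ‖fourier μ (ξ.mulShift y)‖ ^ 2
      = ∑ x, autoConv μ x * phi μ (y * x) := by
  have : ((∑ ξ : AddChar R ℂ, ‖fourier μ ξ‖ ^ 2 * ‖fourier μ (ξ.mulShift y)‖ ^ 2 : ℝ) : ℂ)
      = ((∑ x, autoConv μ x * phi μ (y * x) : ℝ) : ℂ) := by
    rw [Complex.ofReal_sum, Complex.ofReal_sum]
    simp_rw [Complex.ofReal_mul, ← sum_normSq_fourier_mul, normSq_fourier μ (AddChar.mulShift _ _),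
      Finset.mul_sum]
    rw [Finset.sum_comm]
    refine Finset.sum_congr rfl fun x _ => Finset.sum_congr rfl fun ξ _ => ?_
    rw [AddChar.mulShift_apply]
    ring
  exact_mod_cast this

/-- Failure of the first alternative, in physical space. -/
theorem le_of_not_fourierDecay {μ : R → ℝ} {τ : ℝ} (h : ¬ FourierDecay τ μ) :
    (Fintype.card R : ℝ) ^ (-τ) * autoConv μ 0
      ≤ ∑ y, μ y * ∑ x, autoConv μ x * autoConv μ (x * y) := by
  unfold FourierDecay at h
  rw [not_lt, fourierEnergy_eq] at h
  have hq : (0 : ℝ) < Fintype.card R := by exact_mod_cast Fintype.card_pos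
  have h2 : ∑ y : R, ∑ ξ : AddChar R ℂ,
        ‖fourier μ ξ‖ ^ 2 * ‖fourier μ (ξ.mulShift y)‖ ^ 2 * μ y
      = Fintype.card R * ∑ y, μ y * ∑ x, autoConv μ x * autoConv μ (x * y) := by
    simp_rw [← Finset.sum_mul, sum_normSq_fourier_mulShift, phi]
    rw [Finset.mul_sum]
    refine Finset.sum_congr rfl fun y _ => ?_
    rw [Finset.sum_mul, Finset.mul_sum, Finset.mul_sum]
    refine Finset.sum_congr rfl fun x _ => ?_
    rw [mul_comm y x]
    ring
  rw [h2, phi] at h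
  refine le_of_mul_le_mul_left ?_ hq
  linarith

end Fourier

section Counting

variable {R : Type*} [CommRing R] [Fintype R] {μ : R → ℝ}

theorem sum_comp_le_card_mul_sum {α β : Type*} [Fintype α] [Fintype β] [DecidableEq β]
    (f : α → β) (g : β → ℝ) (hg : ∀ z, 0 ≤ g z) (F : ℝ)
    (hF : ∀ z, ((Finset.univ.filter fun x => f x = z).card : ℝ) ≤ F) :
    ∑ x, g (f x) ≤ F * ∑ z, g z := by
  rw [← Finset.sum_fiberwise Finset.univ f, Finset.mul_sum]
  refine Finset.sum_le_sum fun z _ => ?_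
  rw [Finset.sum_congr rfl (g := fun _ => g z) fun x hx => by rw [(Finset.mem_filter.1 hx).2],
    Finset.sum_const, nsmul_eq_mul]
  exact mul_le_mul_of_nonneg_right (hF z) (hg z)

theorem IsProbability.sum_mul_le {R : Type*} [Fintype R] {μ : R → ℝ} (hμ : IsProbability μ) {f : R → ℝ} {M : ℝ} (hf : ∀ x, f x ≤ M) :
    ∑ x, μ x * f x ≤ M :=
  calc ∑ x, μ x * f x ≤ ∑ x, μ x * M :=
        Finset.sum_le_sum fun x _ => mul_le_mul_of_nonneg_left (hf x) (hμ.1 x)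
    _ = M := by rw [← Finset.sum_mul, hμ.2, one_mul]

/-- A subset of a level set of the autocorrelation has many differences in a lower level set. -/
theorem IsProbability.card_sub_mem_level_ge (hμ : IsProbability μ) {θ η : ℝ} (hθ : 0 < θ)
    (hη : 2 * η ≤ θ ^ 2) (hη0 : 0 < η) (X : Finset R)
    (hX : ∀ x ∈ X, θ * autoConv μ 0 < autoConv μ x) :
    η * (X.card : ℝ) ^ 2 ≤ (((X ×ˢ X).filter fun z : R × R =>
      η * autoConv μ 0 < autoConv μ (z.1 - z.2)).card : ℝ) := by
  set ν := autoConv μ with hν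
  set κ := ν 0 with hκ
  have hκ0 : 0 < κ := hμ.autoConv_zero_pos
  have hν0 : ∀ x, 0 ≤ ν x := hμ.autoConv_nonneg
  have hνκ : ∀ x, ν x ≤ κ := hμ.autoConv_le
  set Z := (X ×ˢ X).filter fun z : R × R => η * κ < ν (z.1 - z.2) with hZ
  have h1 := sq_sum_mul_autoConv_le μ X (fun _ => (1 : ℝ)) id
  simp only [one_mul, mul_one, id] at h1
  have h2 : X.card * (θ * κ) ≤ ∑ x ∈ X, ν x := by
    rw [← nsmul_eq_mul, ← Finset.sum_const]
    exact Finset.sum_le_sum fun x hx => (hX x hx).le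
  have h3 : ∑ x ∈ X, ∑ y ∈ X, ν (x - y) ≤ η * κ * X.card ^ 2 + κ * Z.card := by
    rw [← Finset.sum_product', ← Finset.sum_filter_not_add_sum_filter _
      (fun z : R × R => η * κ < ν (z.1 - z.2))]
    gcongr ?_ + ?_
    · calc _ ≤ ∑ z ∈ (X ×ˢ X) with ¬ η * κ < ν (z.1 - z.2), η * κ :=
            Finset.sum_le_sum fun z hz => not_lt.1 (Finset.mem_filter.1 hz).2
        _ ≤ ∑ z ∈ X ×ˢ X, η * κ :=
            Finset.sum_le_sum_of_subset_of_nonneg (Finset.filter_subset _ _)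
              fun _ _ _ => by positivity
        _ = _ := by
            rw [Finset.sum_const, nsmul_eq_mul]; push_cast [Finset.card_product]; ring
    · calc _ ≤ ∑ z ∈ Z, κ := Finset.sum_le_sum fun z _ => hνκ _
        _ = _ := by rw [Finset.sum_const, nsmul_eq_mul, mul_comm]
  have h4 : (X.card * (θ * κ)) ^ 2 ≤ κ * (η * κ * X.card ^ 2 + κ * Z.card) :=
    calc _ ≤ (∑ x ∈ X, ν x) ^ 2 := by gcongr
      _ ≤ _ := h1
      _ ≤ _ := by gcongr
  have h5 : (X.card : ℝ) ^ 2 * (2 * η) ≤ X.card ^ 2 * θ ^ 2 := by gcongr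
  have h6 : κ ^ 2 * (η * (X.card : ℝ) ^ 2) ≤ κ ^ 2 * Z.card := by nlinarith [sq_nonneg κ]
  exact le_of_mul_le_mul_left h6 (by positivity)

variable [DecidableEq R]

theorem IsProbability.sum_autoConv_mul_le (hμ : IsProbability μ) {y : R} {F : ℝ}
    (hF : ∀ z, ((Finset.univ.filter fun x => x * y = z).card : ℝ) ≤ F) :
    ∑ x, autoConv μ (x * y) ≤ F := by
  have := sum_comp_le_card_mul_sum (fun x => x * y) (autoConv μ) hμ.autoConv_nonneg F hF
  rwa [hμ.sum_autoConv, mul_one] at this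

/-- Restriction to a level set, and passage from `μ` to its autocorrelation. -/
theorem IsProbability.sum_level_autoConv_ge (hμ : IsProbability μ) {α θ F : ℝ} (hα : 0 < α)
    (hθ : 0 < θ) (hθF : θ * F ≤ α / 4) (J : Finset R) (hJ : mass μ J ≤ α / 4)
    (hF : ∀ y ∉ J, ∀ z, ((Finset.univ.filter fun x => x * y = z).card : ℝ) ≤ F)
    (h : α * autoConv μ 0 ≤ ∑ y, μ y * ∑ x, autoConv μ x * autoConv μ (x * y)) :
    α ^ 2 / 4 * autoConv μ 0 ≤ ∑ x with θ * autoConv μ 0 < autoConv μ x,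
      autoConv μ x * ∑ y, autoConv μ y * autoConv μ (x * y) := by
  set ν := autoConv μ with hν
  set κ := ν 0 with hκ
  have hκ0 : 0 < κ := hμ.autoConv_zero_pos
  have hν0 : ∀ x, 0 ≤ ν x := hμ.autoConv_nonneg
  have hνκ : ∀ x, ν x ≤ κ := hμ.autoConv_le
  have hνP : IsProbability ν := hμ.isProbability_autoConv
  set A := Finset.univ.filter fun x => θ * κ < ν x with hA
  have hsplit : ∑ y, μ y * ∑ x, ν x * ν (x * y)
      ≤ α / 4 * κ + α / 4 * κ + ∑ x ∈ A, ν x * ∑ y, μ y * ν (x * y) := by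
    have h1 : ∀ y, μ y * ∑ x, ν x * ν (x * y) ≤ (if y ∈ J then μ y * κ else 0)
        + μ y * (α / 4 * κ) + μ y * ∑ x ∈ A, ν x * ν (x * y) := by
      intro y
      have hAs : 0 ≤ ∑ x ∈ A, ν x * ν (x * y) :=
        Finset.sum_nonneg fun x _ => mul_nonneg (hν0 _) (hν0 _)
      by_cases hy : y ∈ J
      · rw [if_pos hy]
        have : ∑ x, ν x * ν (x * y) ≤ κ := hνP.sum_mul_le fun x => hνκ _
        have h2 : μ y * ∑ x, ν x * ν (x * y) ≤ μ y * κ :=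
          mul_le_mul_of_nonneg_left this (hμ.1 y)
        have h3 : 0 ≤ μ y * (α / 4 * κ) := mul_nonneg (hμ.1 y) (by positivity)
        have h4 := mul_nonneg (hμ.1 y) hAs
        linarith
      · rw [if_neg hy, zero_add, ← mul_add]
        refine mul_le_mul_of_nonneg_left ?_ (hμ.1 y)
        rw [← Finset.sum_filter_add_sum_filter_not Finset.univ (fun x => θ * κ < ν x), add_comm]
        gcongr ?_ + _
        calc ∑ x with ¬ θ * κ < ν x, ν x * ν (x * y)
            ≤ ∑ x with ¬ θ * κ < ν x, θ * κ * ν (x * y) := by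
              refine Finset.sum_le_sum fun x hx => ?_
              exact mul_le_mul_of_nonneg_right (not_lt.1 (Finset.mem_filter.1 hx).2) (hν0 _)
          _ ≤ ∑ x, θ * κ * ν (x * y) := by
              refine Finset.sum_le_sum_of_subset_of_nonneg (Finset.filter_subset _ _) ?_
              intro x _ _
              have := hν0 (x * y)
              positivity
          _ = θ * κ * ∑ x, ν (x * y) := by rw [Finset.mul_sum]
          _ ≤ θ * κ * F := by gcongr; exact hμ.sum_autoConv_mul_le (hF y hy)
          _ = θ * F * κ := by ring
          _ ≤ _ := by gcongr
    have h2 : ∑ y, ((if y ∈ J then μ y * κ else 0) + μ y * (α / 4 * κ)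
          + μ y * ∑ x ∈ A, ν x * ν (x * y))
        = mass μ J * κ + α / 4 * κ + ∑ x ∈ A, ν x * ∑ y, μ y * ν (x * y) := by
      rw [Finset.sum_add_distrib, Finset.sum_add_distrib, ← Finset.sum_mul (s := Finset.univ), hμ.2,
        one_mul, Finset.sum_ite_mem, Finset.univ_inter, ← Finset.sum_mul, mass]
      congr 1
      simp_rw [Finset.mul_sum]
      rw [Finset.sum_comm]
      exact Finset.sum_congr rfl fun _ _ => Finset.sum_congr rfl fun _ _ => by ring
    refine (Finset.sum_le_sum fun y _ => h1 y).trans (h2.trans_le ?_)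
    gcongr
  have hlow : α / 2 * κ ≤ ∑ x ∈ A, ν x * ∑ y, μ y * ν (x * y) := by linarith
  have hcs : (∑ x ∈ A, ν x * ∑ y, μ y * ν (x * y)) ^ 2
      ≤ κ * ∑ x ∈ A, ν x * ∑ y, ν y * ν (x * y) := by
    have h1 : ∀ x, (∑ y, μ y * ν (x * y)) ^ 2 ≤ κ * ∑ y, ν y * ν (x * y) := by
      intro x
      refine (sq_sum_mul_autoConv_le μ Finset.univ μ (fun y => x * y)).trans_eq ?_
      simp_rw [← mul_sub]
      rw [sum_mul_sum_eq_sum_autoConv μ (fun z => ν (x * z))]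
    have h2 := Finset.sum_sq_le_sum_mul_sum_of_sq_le_mul A
      (r := fun x => ν x * ∑ y, μ y * ν (x * y)) (f := fun x => ν x)
      (g := fun x => ν x * (∑ y, μ y * ν (x * y)) ^ 2) (fun x _ => hν0 x)
      (fun x _ => mul_nonneg (hν0 x) (sq_nonneg _)) (fun x _ => by nlinarith)
    have hT : 0 ≤ ∑ x ∈ A, ν x * (∑ y, μ y * ν (x * y)) ^ 2 :=
      Finset.sum_nonneg fun x _ => mul_nonneg (hν0 x) (sq_nonneg _)
    calc _ ≤ _ := h2
      _ ≤ 1 * ∑ x ∈ A, ν x * (∑ y, μ y * ν (x * y)) ^ 2 := by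
          gcongr
          exact hνP.mass_le_one A
      _ ≤ ∑ x ∈ A, ν x * (κ * ∑ y, ν y * ν (x * y)) := by
          rw [one_mul]
          exact Finset.sum_le_sum fun x _ => mul_le_mul_of_nonneg_left (h1 x) (hν0 x)
      _ = _ := by
          rw [Finset.mul_sum]
          exact Finset.sum_congr rfl fun _ _ => by ring
  refine le_of_mul_le_mul_left ?_ hκ0
  calc κ * (α ^ 2 / 4 * κ) = (α / 2 * κ) ^ 2 := by ring
    _ ≤ _ := by gcongr
    _ ≤ _ := hcs

/-- Many products of elements of the level set `A` by elements of the level set `B` are in `B`. -/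
theorem IsProbability.card_mul_mem_level_ge (hμ : IsProbability μ) {β θ F : ℝ}
    (hβ : 0 < β) (hθ : 0 < θ) (hF1 : 1 ≤ F) (hθF : θ * F ≤ β / 8) (A J : Finset R)
    (hJ : mass (autoConv μ) J ≤ β / 8)
    (hF : ∀ x ∉ J, ∀ z, ((Finset.univ.filter fun y => y * x = z).card : ℝ) ≤ F)
    (h : β * autoConv μ 0 ≤
      ∑ x ∈ A, autoConv μ x * ∑ y, autoConv μ y * autoConv μ (x * y)) :
    β / 2 * ((autoConv μ 0)⁻¹) ^ 2 ≤ (((A ×ˢ Finset.univ).filter fun z : R × R =>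
      (z.1 ∉ J ∧ z.2 ∉ J) ∧ θ * autoConv μ 0 < autoConv μ z.2 ∧
        θ * autoConv μ 0 < autoConv μ (z.1 * z.2)).card : ℝ) := by
  set ν := autoConv μ with hν
  set κ := ν 0 with hκ
  have hκ0 : 0 < κ := hμ.autoConv_zero_pos
  have hν0 : ∀ x, 0 ≤ ν x := hμ.autoConv_nonneg
  have hνκ : ∀ x, ν x ≤ κ := hμ.autoConv_le
  have hνP : IsProbability ν := hμ.isProbability_autoConv
  set Z := (A ×ˢ Finset.univ).filter fun z : R × R =>
      (z.1 ∉ J ∧ z.2 ∉ J) ∧ θ * κ < ν z.2 ∧ θ * κ < ν (z.1 * z.2) with hZ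
  have hterm : ∀ x ∈ A, ∀ y, ν x * (ν y * ν (x * y)) ≤
      (if x ∈ J then ν x * (ν y * κ) else 0) + ν x * (if y ∈ J then ν y * κ else 0)
      + (if x ∈ J then 0 else ν x * (θ * κ * ν (x * y))) + ν x * (ν y * (θ * κ))
      + κ ^ 3 * (if (x, y) ∈ Z then 1 else 0) := by
    intro x hx y
    have a1 := hν0 x
    have a2 := hν0 y
    have a3 := hν0 (x * y)
    have p1 : ν x * (ν y * ν (x * y)) ≤ ν x * (ν y * κ) := by gcongr; exact hνκ _
    have p2 : (0:ℝ) ≤ ν x * (ν y * κ) := by positivity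
    have p3 : (0:ℝ) ≤ ν x * (θ * κ * ν (x * y)) := by positivity
    have p4 : (0:ℝ) ≤ ν x * (ν y * (θ * κ)) := by positivity
    have p5 : (0 : ℝ) ≤ κ ^ 3 * (if (x, y) ∈ Z then 1 else 0) := by positivity
    by_cases hxJ : x ∈ J
    · have p6 : (0 : ℝ) ≤ ν x * (if y ∈ J then ν y * κ else 0) := by positivity
      rw [if_pos hxJ, if_pos hxJ]
      linarith
    rw [if_neg hxJ, if_neg hxJ]
    by_cases hyJ : y ∈ J
    · rw [if_pos hyJ]
      linarith
    rw [if_neg hyJ]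
    by_cases hB : θ * κ < ν y
    · by_cases hxy : θ * κ < ν (x * y)
      · have : (x, y) ∈ Z := by
          rw [hZ, Finset.mem_filter, Finset.mem_product]
          exact ⟨⟨hx, Finset.mem_univ _⟩, ⟨hxJ, hyJ⟩, hB, hxy⟩
        rw [if_pos this]
        have : ν x * (ν y * ν (x * y)) ≤ κ * (κ * κ) := by
          gcongr
          exacts [hνκ _, hνκ _, hνκ _]
        linarith
      · have : ν x * (ν y * ν (x * y)) ≤ ν x * (ν y * (θ * κ)) := by
          gcongr
          exact not_lt.1 hxy
        linarith
    · have : ν x * (ν y * ν (x * y)) ≤ ν x * (θ * κ * ν (x * y)) := by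
        gcongr
        exact not_lt.1 hB
      linarith
  have hsplit : ∑ x ∈ A, ν x * ∑ y, ν y * ν (x * y)
      ≤ β / 8 * κ + β / 8 * κ + β / 8 * κ + β / 8 * κ + κ ^ 3 * Z.card := by
    simp_rw [Finset.mul_sum]
    refine (Finset.sum_le_sum fun x hx => Finset.sum_le_sum fun y _ => hterm x hx y).trans ?_
    simp_rw [Finset.sum_add_distrib]
    have hAle : ∀ c : ℝ, 0 ≤ c → ∑ x ∈ A, ν x * c ≤ c := by
      intro c hc
      rw [← Finset.sum_mul]
      exact mul_le_of_le_one_left hc (hνP.mass_le_one A)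
    gcongr ?_ + ?_ + ?_ + ?_ + ?_
    · calc ∑ x ∈ A, ∑ y, (if x ∈ J then ν x * (ν y * κ) else 0)
          = ∑ x ∈ A, (if x ∈ J then ν x * κ else 0) := by
            refine Finset.sum_congr rfl fun x _ => ?_
            split_ifs
            · rw [← Finset.mul_sum, ← Finset.sum_mul, hνP.2, one_mul]
            · simp
        _ ≤ ∑ x, (if x ∈ J then ν x * κ else 0) := by
            refine Finset.sum_le_sum_of_subset_of_nonneg (Finset.subset_univ _) fun x _ _ => ?_
            have := hν0 x
            positivity
        _ = mass ν J * κ := by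
            rw [Finset.sum_ite_mem, Finset.univ_inter, ← Finset.sum_mul, mass]
        _ ≤ _ := by gcongr
    · calc ∑ x ∈ A, ∑ y, ν x * (if y ∈ J then ν y * κ else 0)
          = ∑ x ∈ A, ν x * (mass ν J * κ) := by
            refine Finset.sum_congr rfl fun x _ => ?_
            rw [← Finset.mul_sum, Finset.sum_ite_mem, Finset.univ_inter, ← Finset.sum_mul, mass]
        _ ≤ ∑ x ∈ A, ν x * (β / 8 * κ) := by
            refine Finset.sum_le_sum fun x _ => ?_
            have := hν0 x
            gcongr
        _ ≤ _ := hAle _ (by positivity)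
    · calc ∑ x ∈ A, ∑ y, (if x ∈ J then 0 else ν x * (θ * κ * ν (x * y)))
          ≤ ∑ x ∈ A, ν x * (β / 8 * κ) := by
            refine Finset.sum_le_sum fun x _ => ?_
            have h0 := hν0 x
            split_ifs with hxJ
            · rw [Finset.sum_const_zero]; positivity
            · rw [← Finset.mul_sum, ← Finset.mul_sum]
              have := hμ.sum_autoConv_mul_le (hF x hxJ)
              simp_rw [mul_comm _ x] at this
              calc ν x * (θ * κ * ∑ y, ν (x * y)) ≤ ν x * (θ * κ * F) := by gcongr
                _ = ν x * (θ * F * κ) := by ring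
                _ ≤ _ := by gcongr
        _ ≤ _ := hAle _ (by positivity)
    · calc ∑ x ∈ A, ∑ y, ν x * (ν y * (θ * κ)) = ∑ x ∈ A, ν x * (θ * κ) := by
            refine Finset.sum_congr rfl fun x _ => ?_
            rw [← Finset.mul_sum, ← Finset.sum_mul, hνP.2, one_mul]
        _ ≤ θ * κ := hAle _ (by positivity)
        _ ≤ β / 8 * κ := by
            gcongr
            exact (le_mul_of_one_le_right hθ.le hF1).trans hθF
    · simp_rw [← Finset.mul_sum]
      gcongr
      rw [← Finset.sum_product', Finset.sum_boole]
      norm_cast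
      exact Finset.card_le_card fun z hz => (Finset.mem_filter.1 hz).2
  have h2 : β / 2 * κ ≤ κ ^ 3 * Z.card := by linarith
  have h3 : β / 2 * (κ⁻¹) ^ 2 = β / 2 * κ / κ ^ 3 := by field_simp
  rw [h3, div_le_iff₀ (by positivity)]
  linarith

end Counting

section ResidueRing

variable {O : Type*} [CommRing O] [IsDedekindDomain O] (P : HeightOneSpectrum O)

theorem pow_mem_pow_and_notMem {ϖ : O} (h1 : ϖ ∈ P.asIdeal) (h2 : ϖ ∉ P.asIdeal ^ 2) (k : ℕ) :
    ϖ ^ k ∈ P.asIdeal ^ k ∧ ϖ ^ k ∉ P.asIdeal ^ (k + 1) := by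
  have h : emultiplicity P.asIdeal (Ideal.span {ϖ}) = (1 : ℕ) := by
    rw [emultiplicity_eq_coe, pow_one, Ideal.dvd_span_singleton, Ideal.dvd_span_singleton]
    exact ⟨h1, h2⟩
  have h' := emultiplicity_pow P.prime (a := Ideal.span {ϖ}) (k := k)
  rw [h, ← Nat.cast_mul, mul_one, Ideal.span_singleton_pow, emultiplicity_eq_coe,
    Ideal.dvd_span_singleton, Ideal.dvd_span_singleton] at h'
  exact h'

theorem exists_pow_mul_add {ϖ : O} (h1 : ϖ ∈ P.asIdeal) (h2 : ϖ ∉ P.asIdeal ^ 2) (k j : ℕ)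
    {x : O} (hx : x ∈ P.asIdeal ^ k) : ∃ d, ∃ e ∈ P.asIdeal ^ (k + j), ϖ ^ k * d + e = x := by
  induction j with
  | zero => exact ⟨0, x, hx, by ring⟩
  | succ j ih =>
    obtain ⟨d, e, he, rfl⟩ := ih
    obtain ⟨h3, h4⟩ := pow_mem_pow_and_notMem P h1 h2 (k + j)
    obtain ⟨d', e', he', rfl⟩ := Ideal.exists_mul_add_mem_pow_succ P.ne_bot _ e h3 h4 he
    exact ⟨d + ϖ ^ j * d', e', he', by ring⟩

theorem factorPow_mk_eq_zero_iff {O : Type*} [CommRing O] (I : Ideal O) {m n : ℕ} (hm : m ≤ n) (a : O) :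
    Ideal.Quotient.factorPow I hm (Ideal.Quotient.mk (I ^ n) a) = 0 ↔ a ∈ I ^ m := by
  rw [Ideal.Quotient.factor_mk, Ideal.Quotient.eq_zero_iff_mem]

theorem exists_eq_pow_mul {ϖ : O} (h1 : ϖ ∈ P.asIdeal) (h2 : ϖ ∉ P.asIdeal ^ 2) {m n : ℕ}
    (hm : m ≤ n) {x : O ⧸ P.asIdeal ^ n} (hx : Ideal.Quotient.factorPow P.asIdeal hm x = 0) :
    ∃ y, x = Ideal.Quotient.mk (P.asIdeal ^ n) ϖ ^ m * y := by
  obtain ⟨a, rfl⟩ := Ideal.Quotient.mk_surjective x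
  rw [factorPow_mk_eq_zero_iff] at hx
  obtain ⟨d, e, he, rfl⟩ := exists_pow_mul_add P h1 h2 m (n - m) hx
  refine ⟨Ideal.Quotient.mk _ d, ?_⟩
  rw [Nat.add_sub_of_le hm] at he
  rw [map_add, Ideal.Quotient.eq_zero_iff_mem.2 he, add_zero, map_mul, map_pow]

theorem isUnit_mk_of_notMem {d : O} (hd : d ∉ P.asIdeal) (n : ℕ) :
    IsUnit (Ideal.Quotient.mk (P.asIdeal ^ n) d) := by
  have h : IsCoprime (Ideal.span {d}) P.asIdeal := by
    obtain ⟨y, i, hi, hyi⟩ := P.isMaximal.exists_inv hd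
    rw [Ideal.isCoprime_iff_exists]
    exact ⟨y * d, Ideal.mul_mem_left _ _ (Ideal.mem_span_singleton_self d), i, hi, hyi⟩
  have h' : IsCoprime (Ideal.span {d}) (P.asIdeal ^ n) := h.pow_right
  rw [Ideal.isCoprime_iff_exists] at h'
  obtain ⟨i, hi, j, hj, hij⟩ := h'
  obtain ⟨c, rfl⟩ := Ideal.mem_span_singleton'.1 hi
  refine IsUnit.of_mul_eq_one (Ideal.Quotient.mk _ c) ?_
  rw [← map_mul, mul_comm, eq_sub_of_add_eq hij, map_sub, Ideal.Quotient.eq_zero_iff_mem.2 hj,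
    sub_zero, map_one]

/-- An element outside the kernel of reduction modulo `P ^ m` is `ϖ ^ k` times a unit, `k < m`. -/
theorem exists_eq_pow_mul_unit {ϖ : O} (h1 : ϖ ∈ P.asIdeal) (h2 : ϖ ∉ P.asIdeal ^ 2) {m n : ℕ}
    (hm : m ≤ n) {x : O ⧸ P.asIdeal ^ n} (hx : Ideal.Quotient.factorPow P.asIdeal hm x ≠ 0) :
    ∃ k < m, ∃ u : (O ⧸ P.asIdeal ^ n)ˣ, x = Ideal.Quotient.mk (P.asIdeal ^ n) ϖ ^ k * u := by
  classical
  obtain ⟨a, rfl⟩ := Ideal.Quotient.mk_surjective x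
  rw [Ne, factorPow_mk_eq_zero_iff] at hx
  have hex : ∃ j, a ∉ P.asIdeal ^ j := ⟨m, hx⟩
  obtain ⟨k, hk⟩ : ∃ k, Nat.find hex = k + 1 := by
    refine Nat.exists_eq_succ_of_ne_zero fun h0 => ?_
    have := Nat.find_spec hex
    rw [h0, pow_zero, Ideal.one_eq_top] at this
    exact this trivial
  have hkm : k < m := by
    have := Nat.find_min' hex hx
    omega
  have ha : a ∈ P.asIdeal ^ k := by
    have := Nat.find_min hex (m := k) (by omega)
    simpa using this
  have ha' : a ∉ P.asIdeal ^ (k + 1) := hk ▸ Nat.find_spec hex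
  obtain ⟨d, e, he, rfl⟩ := exists_pow_mul_add P h1 h2 k (n - k) ha
  rw [Nat.add_sub_of_le (by omega)] at he
  have hd : d ∉ P.asIdeal := by
    intro hd
    refine ha' (Ideal.add_mem _ ?_ (Ideal.pow_le_pow_right (by omega) he))
    rw [pow_succ]
    exact Ideal.mul_mem_mul (pow_mem_pow_and_notMem P h1 h2 k).1 hd
  obtain ⟨u, hu⟩ := isUnit_mk_of_notMem P hd n
  refine ⟨k, hkm, u, ?_⟩
  rw [map_add, Ideal.Quotient.eq_zero_iff_mem.2 he, add_zero, map_mul, map_pow, hu]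

theorem card_quotient_pow (n : ℕ) :
    Nat.card (O ⧸ P.asIdeal ^ n) = Nat.card (O ⧸ P.asIdeal) ^ n := by
  have := P.isPrime
  have := cardQuot_pow_of_prime (P := P.asIdeal) P.ne_bot (i := n)
  rwa [Submodule.cardQuot_apply, Submodule.cardQuot_apply] at this

/-- The fibres of multiplication by `ϖ ^ k` have at most `|O ⧸ P| ^ k` elements. -/
theorem card_fiber_pow_mul_le [∀ n, Finite (O ⧸ P.asIdeal ^ n)] {ϖ : O} (h1 : ϖ ∈ P.asIdeal)
    (h2 : ϖ ∉ P.asIdeal ^ 2) (n k : ℕ) [Fintype (O ⧸ P.asIdeal ^ n)]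
    [DecidableEq (O ⧸ P.asIdeal ^ n)] (z : O ⧸ P.asIdeal ^ n) :
    (Finset.univ.filter fun x => Ideal.Quotient.mk (P.asIdeal ^ n) ϖ ^ k * x = z).card
      ≤ Nat.card (O ⧸ P.asIdeal) ^ k := by
  classical
  set ω := Ideal.Quotient.mk (P.asIdeal ^ n) ϖ
  have hpos : 0 < Nat.card (O ⧸ P.asIdeal) := by
    have : Finite (O ⧸ P.asIdeal) := by
      have : Finite (O ⧸ P.asIdeal ^ 1) := inferInstance
      rwa [pow_one] at this
    exact Nat.card_pos
  rcases le_total n k with hnk | hkn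
  · refine (Finset.card_le_univ _).trans ?_
    rw [← Nat.card_eq_fintype_card, card_quotient_pow]
    exact Nat.pow_le_pow_right hpos hnk
  have : Fintype (O ⧸ P.asIdeal ^ k) := Fintype.ofFinite _
  rw [← card_quotient_pow, Nat.card_eq_fintype_card]
  rcases (Finset.univ.filter fun x => ω ^ k * x = z).eq_empty_or_nonempty with h0 | ⟨x₀, hx₀⟩
  · rw [h0]; simp
  have hx₀ : ω ^ k * x₀ = z := (Finset.mem_filter.1 hx₀).2
  set I := Finset.univ.image fun x => ω ^ k * x with hI
  have hfib : ∀ w ∈ I, (Finset.univ.filter fun x => ω ^ k * x = z).card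
      = (Finset.univ.filter fun x => ω ^ k * x = w).card := by
    intro w hw
    obtain ⟨x₁, -, rfl⟩ := Finset.mem_image.1 hw
    refine Finset.card_bij (fun x _ => x - x₀ + x₁) ?_ ?_ ?_
    · intro x hx
      have hx := (Finset.mem_filter.1 hx).2
      refine Finset.mem_filter.2 ⟨Finset.mem_univ _, ?_⟩
      rw [mul_add, mul_sub, hx, hx₀]
      ring
    · intro x _ y _ h
      simpa using h
    · intro y hy
      have hy := (Finset.mem_filter.1 hy).2
      refine ⟨y - x₁ + x₀, Finset.mem_filter.2 ⟨Finset.mem_univ _, ?_⟩, by ring⟩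
      rw [mul_add, mul_sub, hy, hx₀]
      ring
  have hc1 : Fintype.card (O ⧸ P.asIdeal ^ n)
      = I.card * (Finset.univ.filter fun x => ω ^ k * x = z).card := by
    rw [← Finset.card_univ, Finset.card_eq_sum_card_image (fun x => ω ^ k * x), ← hI,
      ← Finset.sum_congr rfl hfib, Finset.sum_const, smul_eq_mul]
  have hc2 : Fintype.card (O ⧸ P.asIdeal ^ n) ≤ I.card * Fintype.card (O ⧸ P.asIdeal ^ k) := by
    rw [← Finset.card_univ, ← Finset.card_univ (α := O ⧸ P.asIdeal ^ k)]
    refine Finset.card_le_mul_card_image_of_maps_to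
      (f := Ideal.Quotient.factorPow P.asIdeal hkn) (fun _ _ => Finset.mem_univ _) _ ?_
    intro t _
    rcases (Finset.univ.filter fun x =>
      Ideal.Quotient.factorPow P.asIdeal hkn x = t).eq_empty_or_nonempty with h0 | ⟨y₀, hy₀⟩
    · rw [h0]; simp
    have hy₀ := (Finset.mem_filter.1 hy₀).2
    refine Finset.card_le_card_of_injOn (fun x => x - y₀) ?_ fun x _ y _ h => by simpa using h
    intro x hx
    have hx := (Finset.mem_filter.1 (Finset.mem_coe.1 hx)).2
    obtain ⟨y, hy⟩ := exists_eq_pow_mul P h1 h2 hkn (x := x - y₀) (by rw [map_sub, hx, hy₀, sub_self])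
    exact Finset.mem_coe.2 (Finset.mem_image.2 ⟨y, Finset.mem_univ _, hy.symm⟩)
  refine Nat.le_of_mul_le_mul_left (hc1 ▸ hc2) (Finset.card_pos.2 ⟨z, ?_⟩)
  exact Finset.mem_image.2 ⟨x₀, Finset.mem_univ _, hx₀⟩

end ResidueRing

section Construction

variable {R : Type*} [CommRing R] [Fintype R] [DecidableEq R]

theorem card_units_pow_mul_mem_le {ω : R} {k : ℕ} {F : ℝ}
    (hfib : ∀ z, ((Finset.univ.filter fun x => ω ^ k * x = z).card : ℝ) ≤ F)
    (U : Finset Rˣ) (T : Finset R) (h : ∀ u ∈ U, ω ^ k * (u : R) ∈ T) :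
    (U.card : ℝ) ≤ F * T.card := by
  calc (U.card : ℝ) = ∑ z ∈ T, ((U.filter fun u : Rˣ => ω ^ k * (u : R) = z).card : ℝ) := by
        exact_mod_cast Finset.card_eq_sum_card_fiberwise h
    _ ≤ ∑ z ∈ T, F := by
        refine Finset.sum_le_sum fun z _ => le_trans ?_ (hfib z)
        norm_cast
        refine Finset.card_le_card_of_injOn (fun u : Rˣ => (u : R)) ?_ fun x _ y _ h => Units.ext h
        intro u hu
        simpa using (Finset.mem_filter.1 (Finset.mem_coe.1 hu)).2
    _ = F * T.card := by rw [Finset.sum_const, nsmul_eq_mul, mul_comm]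

theorem card_le_mul_card_of_pow_mul_mem {ω : R} {k : ℕ} {F : ℝ}
    (hfib : ∀ z, ((Finset.univ.filter fun x => ω ^ k * x = z).card : ℝ) ≤ F)
    (S T : Finset R) (h : ∀ u ∈ S, ω ^ k * u ∈ T) :
    (S.card : ℝ) ≤ F * T.card := by
  calc (S.card : ℝ) = ∑ z ∈ T, ((S.filter fun u => ω ^ k * u = z).card : ℝ) := by
        exact_mod_cast Finset.card_eq_sum_card_fiberwise h
    _ ≤ ∑ z ∈ T, F := by
        refine Finset.sum_le_sum fun z _ => le_trans ?_ (hfib z)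
        norm_cast
        exact Finset.card_le_card (Finset.filter_subset_filter _ (Finset.subset_univ _))
    _ = F * T.card := by rw [Finset.sum_const, nsmul_eq_mul, mul_comm]

/-- Pairs of elements of small valuation lift to pairs of units; fix the valuations. -/
theorem exists_valuations_card_ge (ω : R) {m : ℕ} (hm : 0 < m) (J : Finset R)
    (hJ : ∀ x ∉ J, ∃ k < m, ∃ u : Rˣ, x = ω ^ k * u) (A B : R → Prop) [DecidablePred A]
    [DecidablePred B] {N : ℝ}
    (h : (m : ℝ) ^ 2 * N ≤ ((Finset.univ.filter fun z : R × R =>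
      A z.1 ∧ (z.1 ∉ J ∧ z.2 ∉ J) ∧ B z.2 ∧ B (z.1 * z.2)).card : ℝ)) :
    ∃ k < m, ∃ l < m, N ≤ ((Finset.univ.filter fun w : Rˣ × Rˣ =>
      A (ω ^ k * w.1) ∧ B (ω ^ l * w.2) ∧ B (ω ^ (k + l) * (w.1 * w.2 : Rˣ))).card : ℝ) := by
  set Z := Finset.univ.filter fun z : R × R =>
      A z.1 ∧ (z.1 ∉ J ∧ z.2 ∉ J) ∧ B z.2 ∧ B (z.1 * z.2) with hZ
  set T : ℕ × ℕ → Finset (Rˣ × Rˣ) := fun p => Finset.univ.filter fun w : Rˣ × Rˣ =>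
      A (ω ^ p.1 * w.1) ∧ B (ω ^ p.2 * w.2) ∧ B (ω ^ (p.1 + p.2) * (w.1 * w.2 : Rˣ)) with hT
  by_contra! hcon
  have hlt : ∀ p ∈ Finset.range m ×ˢ Finset.range m, ((T p).card : ℝ) < N := fun p hp => by
    rw [Finset.mem_product, Finset.mem_range, Finset.mem_range] at hp
    exact hcon p.1 hp.1 p.2 hp.2
  have hsub : Z ⊆ (Finset.range m ×ˢ Finset.range m).biUnion fun p =>
      (T p).image fun w => (ω ^ p.1 * (w.1 : R), ω ^ p.2 * (w.2 : R)) := by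
    rintro ⟨x, y⟩ hz
    obtain ⟨hA, ⟨hx, hy⟩, hB, hAB⟩ := (Finset.mem_filter.1 hz).2
    obtain ⟨k, hk, u, rfl⟩ := hJ x hx
    obtain ⟨l, hl, v, rfl⟩ := hJ y hy
    refine Finset.mem_biUnion.2 ⟨(k, l), Finset.mem_product.2
      ⟨Finset.mem_range.2 hk, Finset.mem_range.2 hl⟩, Finset.mem_image.2 ⟨(u, v), ?_, rfl⟩⟩
    refine Finset.mem_filter.2 ⟨Finset.mem_univ _, hA, hB, ?_⟩
    convert hAB using 1
    push_cast
    ring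
  have hle : (Z.card : ℝ) ≤ ∑ p ∈ Finset.range m ×ˢ Finset.range m, ((T p).card : ℝ) := by
    norm_cast
    exact (Finset.card_le_card hsub).trans (Finset.card_biUnion_le.trans
      (Finset.sum_le_sum fun p _ => Finset.card_image_le))
  have hlt' := Finset.sum_lt_sum_of_nonempty (s := Finset.range m ×ˢ Finset.range m)
    ⟨(0, 0), by simp [hm]⟩ hlt
  rw [Finset.sum_const, nsmul_eq_mul] at hlt'
  push_cast [Finset.card_product, Finset.card_range] at hlt'
  linarith [sq (m : ℝ)]

/-- A unit set `U` with small product set, whose dilate by `ω ^ k` lies in a level set of the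
autocorrelation, contains a set with small sum set and product set. -/
theorem IsProbability.exists_sumProduct_subset {μ : R → ℝ} (hμ : IsProbability μ) {ω : R} {k : ℕ}
    {h : ℝ} (hh : 4096 ≤ h)
    (hfib : ∀ z, ((Finset.univ.filter fun x => ω ^ k * x = z).card : ℝ) ≤ h ^ 2)
    (U : Finset Rˣ) (hU : (autoConv μ 0)⁻¹ / (4 * h ^ 16) ≤ U.card)
    (hUU : ((U * U).card : ℝ) ≤ (4096 * h ^ 144) ^ 2 * U.card)
    (hUA : ∀ u ∈ U, (h ^ 2)⁻¹ * autoConv μ 0 < autoConv μ (ω ^ k * (u : R))) :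
    ∃ S : Finset R, (∀ x ∈ S, IsUnit x) ∧
      ((S + S).card : ℝ) + (S * S).card < h ^ 1600 * S.card ∧
      (S.image (ω ^ k * ·)).card = S.card ∧
      (∀ x ∈ S.image (ω ^ k * ·), (h ^ 2)⁻¹ * autoConv μ 0 < autoConv μ x) ∧
      (h ^ 1600)⁻¹ < mass (autoConv μ) (S.image (ω ^ k * ·)) := by
  have hκ := hμ.autoConv_zero_pos
  set κ := autoConv μ 0 with hκdef
  set L := κ⁻¹ with hL
  have hL0 : 0 < L := inv_pos.2 hκ
  have h1 : 1 ≤ h := by linarith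
  have h0 : 0 < h := by linarith
  set X := U.image fun u : Rˣ => ω ^ k * (u : R) with hX
  have hXA : ∀ x ∈ X, (h ^ 2)⁻¹ * κ < autoConv μ x := by
    intro x hx
    obtain ⟨u, hu, rfl⟩ := Finset.mem_image.1 hx
    exact hUA u hu
  have hUX : (U.card : ℝ) ≤ h ^ 2 * X.card :=
    card_units_pow_mul_mem_le hfib U X fun u hu => Finset.mem_image_of_mem _ hu
  have hXle : (X.card : ℝ) ≤ h ^ 2 * L := by
    have := hμ.card_level_le (by positivity) X hXA
    rwa [inv_inv] at this
  have hXge : L / (4 * h ^ 18) ≤ X.card := by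
    refine le_of_mul_le_mul_left ?_ (show 0 < h ^ 2 by positivity)
    calc h ^ 2 * (L / (4 * h ^ 18)) = L / (4 * h ^ 16) := by field_simp
      _ ≤ _ := hU.trans hUX
  have hdiff := hμ.card_sub_mem_level_ge (θ := (h ^ 2)⁻¹) (η := (h ^ 5)⁻¹) (by positivity) (by
    rw [inv_pow, ← pow_mul, ← div_eq_mul_inv, div_le_iff₀ (by positivity)]
    have : ((h ^ (2 * 2))⁻¹ * h ^ 5 : ℝ) = h := by field_simp
    rw [this]
    linarith) (by positivity) X hXA
  set D := Finset.univ.filter fun x => (h ^ 5)⁻¹ * κ < autoConv μ x with hD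
  have hDle : (D.card : ℝ) ≤ h ^ 5 * L := by
    have := hμ.card_level_le (θ := (h ^ 5)⁻¹) (by positivity) D
      fun x hx => (Finset.mem_filter.1 hx).2
    rwa [inv_inv] at this
  have hedge : L ^ 2 / h ^ 42 ≤ (((X ×ˢ (-X)).filter fun z : R × R => z.1 + z.2 ∈ D).card : ℝ) := by
    calc L ^ 2 / h ^ 42 ≤ (h ^ 5)⁻¹ * (L / (4 * h ^ 18)) ^ 2 := by
          have : (h ^ 5)⁻¹ * (L / (4 * h ^ 18)) ^ 2 = L ^ 2 / (16 * h ^ 41) := by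
            field_simp; norm_num
          rw [this]
          have h3 : 16 * h ^ 41 ≤ h ^ 42 := by
            rw [pow_succ' h 41]; gcongr; linarith
          gcongr
      _ ≤ (h ^ 5)⁻¹ * (X.card : ℝ) ^ 2 := by gcongr
      _ ≤ _ := hdiff
      _ ≤ _ := by
          norm_cast
          refine Finset.card_le_card_of_injOn (fun z => (z.1, -z.2)) ?_ ?_
          · intro z hz
            have hz := Finset.mem_filter.1 (Finset.mem_coe.1 hz)
            rw [Finset.mem_product] at hz
            refine Finset.mem_coe.2 (Finset.mem_filter.2 ⟨Finset.mem_product.2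
              ⟨hz.1.1, Finset.neg_mem_neg hz.1.2⟩, Finset.mem_filter.2 ⟨Finset.mem_univ _, ?_⟩⟩)
            rw [← sub_eq_add_neg]
            exact hz.2
          · rintro ⟨x, y⟩ _ ⟨x', y'⟩ _ hxy
            simpa using hxy
  have hpow : ∀ {i j : ℕ}, i ≤ j → h ^ i ≤ h ^ j := fun hij => pow_le_pow_right₀ h1 hij
  obtain ⟨Y, hYX, hYge, hYY⟩ := exists_subset_card_add_self_le X (-X) D L (h ^ 42) hL0
    (by positivity) (hXle.trans (by gcongr ?_ * _; exact hpow (by norm_num)))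
    (by rw [Finset.card_neg]; exact hXle.trans (by gcongr ?_ * _; exact hpow (by norm_num)))
    (hDle.trans (by gcongr ?_ * _; exact hpow (by norm_num))) hedge
  rw [← pow_mul] at hYge hYY
  norm_num only at hYge hYY
  have hsec : ∀ x : R, ∃ u : Rˣ, x ∈ Y → u ∈ U ∧ ω ^ k * (u : R) = x := by
    intro x
    by_cases hx : x ∈ Y
    · obtain ⟨u, hu, hux⟩ := Finset.mem_image.1 (hYX hx)
      exact ⟨u, fun _ => ⟨hu, hux⟩⟩
    · exact ⟨1, fun h => absurd h hx⟩
  choose g hg using hsec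
  set S := Y.image fun x => (g x : R) with hS
  have hSY : S.image (ω ^ k * ·) = Y := by
    rw [hS, Finset.image_image]
    conv_rhs => rw [← Finset.image_id (s := Y)]
    exact Finset.image_congr fun x hx => (hg x hx).2
  have hScard : S.card = Y.card :=
    le_antisymm Finset.card_image_le (by
      conv_lhs => rw [← hSY]
      exact Finset.card_image_le)
  have hYpos : (0 : ℝ) < Y.card := lt_of_lt_of_le (by positivity) hYge
  have hmulle : ((S * S).card : ℝ) ≤ h ^ 380 * Y.card := by
    have e1 : S * S ⊆ (U * U).image fun u : Rˣ => (u : R) := by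
      intro x hx
      obtain ⟨a, ha, b, hb, rfl⟩ := Finset.mem_mul.1 hx
      obtain ⟨x, hxY, rfl⟩ := Finset.mem_image.1 ha
      obtain ⟨y, hyY, rfl⟩ := Finset.mem_image.1 hb
      exact Finset.mem_image.2 ⟨g x * g y, Finset.mul_mem_mul (hg x hxY).1 (hg y hyY).1, rfl⟩
    calc ((S * S).card : ℝ) ≤ (U * U).card := by
          exact_mod_cast (Finset.card_le_card e1).trans Finset.card_image_le
      _ ≤ (4096 * h ^ 144) ^ 2 * U.card := hUU
      _ ≤ (4096 * h ^ 144) ^ 2 * (h ^ 2 * (h ^ 2 * L)) := by gcongr; exact hUX.trans (by gcongr)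
      _ = 4096 ^ 2 * 4 * h ^ 376 * (L / (4 * h ^ 84)) := by field_simp
      _ ≤ h ^ 2 * h * h ^ 376 * Y.card := by gcongr; linarith
      _ ≤ h ^ 380 * Y.card := by
          rw [← pow_succ, ← pow_add]
          gcongr ?_ * _
          exact hpow (by norm_num)
  have haddle : ((S + S).card : ℝ) ≤ h ^ 1520 * Y.card := by
    have e1 : ∀ u ∈ S + S, ω ^ k * u ∈ Y + Y := by
      intro x hx
      obtain ⟨a, ha, b, hb, rfl⟩ := Finset.mem_add.1 hx
      rw [mul_add, ← hSY]
      exact Finset.add_mem_add (Finset.mem_image_of_mem _ ha) (Finset.mem_image_of_mem _ hb)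
    calc ((S + S).card : ℝ) ≤ h ^ 2 * (Y + Y).card := card_le_mul_card_of_pow_mul_mem hfib _ _ e1
      _ ≤ h ^ 2 * ((4096 * h ^ 756) ^ 2 * Y.card) := by gcongr
      _ ≤ h ^ 2 * ((h * h ^ 756) ^ 2 * Y.card) := by gcongr
      _ = h ^ 1516 * Y.card := by rw [← pow_succ', ← pow_mul, ← mul_assoc, ← pow_add]
      _ ≤ h ^ 1520 * Y.card := by
          gcongr ?_ * _
          exact hpow (by norm_num)
  refine ⟨S, ?_, ?_, ?_, ?_, ?_⟩
  · intro x hx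
    obtain ⟨y, _, rfl⟩ := Finset.mem_image.1 hx
    exact (g y).isUnit
  · rw [hScard]
    calc _ ≤ h ^ 1520 * Y.card + h ^ 380 * Y.card := add_le_add haddle hmulle
      _ ≤ h ^ 1520 * Y.card + h ^ 1520 * Y.card := by
          gcongr _ + ?_ * _
          exact hpow (by norm_num)
      _ = 2 * h ^ 1520 * Y.card := by ring
      _ < h * h ^ 1520 * Y.card := by gcongr; linarith
      _ = h ^ 1521 * Y.card := by rw [← pow_succ']
      _ ≤ h ^ 1600 * Y.card := by
          gcongr ?_ * _
          exact hpow (by norm_num)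
  · rw [hSY, hScard]
  · rw [hSY]
    exact fun x hx => hXA x (hYX hx)
  · rw [hSY]
    calc (h ^ 1600)⁻¹ < (4 * h ^ 86)⁻¹ := by
          gcongr
          calc 4 * h ^ 86 < h * h ^ 86 := by gcongr; linarith
            _ = h ^ 87 := by rw [← pow_succ']
            _ ≤ _ := hpow (by norm_num)
      _ = L / (4 * h ^ 84) * ((h ^ 2)⁻¹ * κ) := by rw [hL]; field_simp
      _ ≤ Y.card * ((h ^ 2)⁻¹ * κ) := by gcongr
      _ = ∑ x ∈ Y, (h ^ 2)⁻¹ * κ := by rw [Finset.sum_const, nsmul_eq_mul]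
      _ ≤ mass (autoConv μ) Y := Finset.sum_le_sum fun x hx => (hXA x (hYX hx)).le

/-- Many multiplicative triples in level sets of the autocorrelation produce a set with small
sum set and product set. -/
theorem IsProbability.exists_sumProduct_set {μ : R → ℝ} (hμ : IsProbability μ) {ω : R} {m : ℕ}
    (hm : 0 < m) {h : ℝ} (hh : 4096 ≤ h) (hmh : (m : ℝ) ^ 2 ≤ h)
    (hfib : ∀ k, k + 2 ≤ 2 * m → ∀ z, ((Finset.univ.filter fun x => ω ^ k * x = z).card : ℝ) ≤ h ^ 4)
    (hfib' : ∀ k < m, ∀ z, ((Finset.univ.filter fun x => ω ^ k * x = z).card : ℝ) ≤ h ^ 2)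
    (J : Finset R) (hJ : ∀ x ∉ J, ∃ k < m, ∃ u : Rˣ, x = ω ^ k * u)
    (hcount : (h ^ 3)⁻¹ * ((autoConv μ 0)⁻¹) ^ 2 ≤ ((Finset.univ.filter fun z : R × R =>
      (h ^ 2)⁻¹ * autoConv μ 0 < autoConv μ z.1 ∧ (z.1 ∉ J ∧ z.2 ∉ J) ∧
      (h ^ 4)⁻¹ * autoConv μ 0 < autoConv μ z.2 ∧
      (h ^ 4)⁻¹ * autoConv μ 0 < autoConv μ (z.1 * z.2)).card : ℝ)) :
    ∃ S : Finset R, ∃ k < m, (∀ x ∈ S, IsUnit x) ∧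
      ((S + S).card : ℝ) + (S * S).card < h ^ 1600 * S.card ∧
      (S.image (ω ^ k * ·)).card = S.card ∧
      (∀ x ∈ S.image (ω ^ k * ·), (h ^ 2)⁻¹ * autoConv μ 0 < autoConv μ x) ∧
      (h ^ 1600)⁻¹ < mass (autoConv μ) (S.image (ω ^ k * ·)) := by
  have hκ := hμ.autoConv_zero_pos
  set κ := autoConv μ 0 with hκdef
  set L := κ⁻¹ with hL
  have hL0 : 0 < L := inv_pos.2 hκ
  have h1 : 1 ≤ h := by linarith
  have h0 : 0 < h := by linarith
  obtain ⟨k, hk, l, hl, hkl⟩ := exists_valuations_card_ge ω hm J hJ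
    (fun x => (h ^ 2)⁻¹ * κ < autoConv μ x) (fun x => (h ^ 4)⁻¹ * κ < autoConv μ x)
    (N := L ^ 2 / h ^ 4) (by
      refine le_trans ?_ hcount
      calc (m : ℝ) ^ 2 * (L ^ 2 / h ^ 4) ≤ h * (L ^ 2 / h ^ 4) := by gcongr
        _ = _ := by field_simp)
  have hlevel : ∀ (i : ℕ) (T : Finset R), (∀ x ∈ T, (h ^ i)⁻¹ * κ < autoConv μ x) →
      (T.card : ℝ) ≤ h ^ i * L := by
    intro i T hT
    have := hμ.card_level_le (θ := (h ^ i)⁻¹) (by positivity) T hT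
    rwa [inv_inv] at this
  have hunits : ∀ (i j r : ℕ), i + r ≤ 8 →
      (∀ z, ((Finset.univ.filter fun x => ω ^ j * x = z).card : ℝ) ≤ h ^ r) →
      (((Finset.univ.filter fun u : Rˣ => (h ^ i)⁻¹ * κ < autoConv μ (ω ^ j * (u : R))).card : ℝ)
        ≤ h ^ 8 * L) := by
    intro i j r hir hf
    set T := Finset.univ.filter fun x => (h ^ i)⁻¹ * κ < autoConv μ x with hT
    calc _ ≤ h ^ r * T.card := card_units_pow_mul_mem_le hf _ T fun u hu => by
          have := (Finset.mem_filter.1 hu).2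
          exact Finset.mem_filter.2 ⟨Finset.mem_univ _, this⟩
      _ ≤ h ^ r * (h ^ i * L) := by
          gcongr
          exact hlevel i T fun x hx => (Finset.mem_filter.1 hx).2
      _ = h ^ (i + r) * L := by ring
      _ ≤ h ^ 8 * L := by gcongr
  have hh84 : h ^ 4 ≤ h ^ 8 := pow_le_pow_right₀ h1 (by norm_num)
  obtain ⟨U, hUsub, hUge, hUU⟩ := exists_subset_card_mul_self_le
    (Finset.univ.filter fun u : Rˣ => (h ^ 2)⁻¹ * κ < autoConv μ (ω ^ k * (u : R)))
    (Finset.univ.filter fun u : Rˣ => (h ^ 4)⁻¹ * κ < autoConv μ (ω ^ l * (u : R)))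
    (Finset.univ.filter fun u : Rˣ => (h ^ 4)⁻¹ * κ < autoConv μ (ω ^ (k + l) * (u : R)))
    L (h ^ 8) hL0 (by positivity) (hunits 2 k 2 (by norm_num) (hfib' k hk))
    (hunits 4 l 2 (by norm_num) (hfib' l hl)) (hunits 4 (k + l) 4 (by norm_num)
      (hfib (k + l) (by omega))) (by
      calc L ^ 2 / h ^ 8 ≤ L ^ 2 / h ^ 4 := by gcongr
        _ ≤ _ := hkl
        _ ≤ _ := by
          norm_cast
          refine Finset.card_le_card fun w hw => ?_
          obtain ⟨a, b, c⟩ := (Finset.mem_filter.1 hw).2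
          simp only [Finset.mem_filter, Finset.mem_product, Finset.mem_univ, true_and]
          exact ⟨⟨a, b⟩, c⟩)
  rw [← pow_mul] at hUge hUU
  norm_num only at hUge hUU
  obtain ⟨S, hS⟩ := hμ.exists_sumProduct_subset hh (hfib' k hk) U hUge hUU
    fun u hu => (Finset.mem_filter.1 (hUsub hu)).2
  exact ⟨S, k, hk, hS⟩

end Construction

theorem mul_pow_le_rpow_of_le {a q s : ℝ} {n k : ℕ} (ha : 1 ≤ a) (hq : q = a ^ n)
    (hk : (k : ℝ) ≤ s * n) : a ^ k ≤ q ^ s := by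
  have ha0 : 0 < a := by linarith
  rw [hq, ← Real.rpow_natCast a n, ← Real.rpow_mul ha0.le, ← Real.rpow_natCast a k]
  exact Real.rpow_le_rpow_of_exponent_le ha (by linarith)

theorem rpow_neg_le_rpow_neg {p d₀ n m : ℕ} {q ε τ s : ℝ} (hp : 1 ≤ p)
    (hq : q = ((p : ℝ) ^ d₀) ^ n) (hε : 0 < ε) (hτ : 0 < τ) (hm : s * (ε * n) ≤ m) :
    (p : ℝ) ^ (-(2 * d₀ * m * τ / ε)) ≤ q ^ (-(2 * s * τ)) := by
  have hp1 : (1 : ℝ) ≤ p := by exact_mod_cast hp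
  have hp0 : (0 : ℝ) ≤ p := by linarith
  rw [hq, ← pow_mul, ← Real.rpow_natCast, ← Real.rpow_mul hp0]
  refine Real.rpow_le_rpow_of_exponent_le hp1 ?_
  push_cast
  rw [mul_neg, neg_le_neg_iff, le_div_iff₀ hε]
  have : (0 : ℝ) ≤ 2 * d₀ * τ := by positivity
  nlinarith [mul_le_mul_of_nonneg_left hm this]

/-- The size conditions on `q` under which the trichotomy is proved. -/
theorem exists_threshold {ε τ c : ℝ} (hτ : 0 < τ) (hτε : τ < ε) :
    ∃ N : ℕ, ∀ q : ℝ, (N : ℝ) ≤ q → 1 ≤ q ∧ 4096 ≤ q ^ ε ∧ 32 ≤ q ^ (ε - τ) ∧ 32 * c ≤ q ^ τ ∧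
      ∀ n : ℕ, (2 : ℝ) ^ n ≤ q → (n : ℝ) ^ 2 ≤ q ^ ε := by
  have hε : 0 < ε := hτ.trans hτε
  have hlog : ∀ᶠ q : ℝ in Filter.atTop, ‖Real.log q‖ ≤ 1 / 2 * ‖q ^ (ε / 2)‖ :=
    (isLittleO_log_rpow_atTop (half_pos hε)).def (by norm_num)
  have h := (Filter.eventually_ge_atTop (1 : ℝ)).and
    (((tendsto_rpow_atTop hε).eventually_ge_atTop 4096).and
    (((tendsto_rpow_atTop (sub_pos.2 hτε)).eventually_ge_atTop 32).and
    (((tendsto_rpow_atTop hτ).eventually_ge_atTop (32 * c)).and hlog)))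
  obtain ⟨M, hM⟩ := Filter.eventually_atTop.1 h
  obtain ⟨N, hN⟩ := exists_nat_ge M
  refine ⟨N, fun q hq => ?_⟩
  obtain ⟨h1, h2, h3, h4, h5⟩ := hM q (hN.trans hq)
  refine ⟨h1, h2, h3, h4, fun n hn => ?_⟩
  have hq0 : 0 < q := by linarith
  rw [Real.norm_of_nonneg (Real.log_nonneg h1), Real.norm_of_nonneg (by positivity)] at h5
  have h6 : n * Real.log 2 ≤ Real.log q := by
    rw [← Real.log_pow]
    exact Real.log_le_log (by positivity) hn
  have h7 : (n : ℝ) ≤ q ^ (ε / 2) := by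
    have : (1 / 2 : ℝ) ≤ Real.log 2 := by linarith [Real.log_two_gt_d9]
    have h8 := mul_le_mul_of_nonneg_left this (Nat.cast_nonneg (α := ℝ) n)
    linarith
  calc (n : ℝ) ^ 2 ≤ (q ^ (ε / 2)) ^ 2 := by gcongr
    _ = q ^ ε := by
      rw [← Real.rpow_natCast, ← Real.rpow_mul hq0.le]
      congr 1
      push_cast
      ring

theorem Concentrated.mono {K : Type*} [Field K] [NumberField K] {P : HeightOneSpectrum (𝓞 K)}
    {n : ℕ} {c c' ε τ : ℝ} {p d₀ : ℕ} {μ : 𝓞 K ⧸ P.asIdeal ^ n → ℝ}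
    (h : Concentrated c ε τ p d₀ μ) (hc : c' ≤ c) : Concentrated c' ε τ p d₀ μ := by
  obtain ⟨m, hm, h1, y, hy⟩ := h
  refine ⟨m, hm, h1, y, lt_of_le_of_lt ?_ hy⟩
  gcongr

theorem concentrated_of_mul_card_lt {K : Type*} [Field K] [NumberField K]
    {P : HeightOneSpectrum (𝓞 K)} {n : ℕ} {c ε τ : ℝ} {p d₀ : ℕ} {μ : 𝓞 K ⧸ P.asIdeal ^ n → ℝ}
    (hμ : IsProbability μ) (hn : 1 ≤ n) (hε : 0 < ε) (hε1 : ε < 1) (hτ : 0 < τ) (hp : 1 ≤ p)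
    (hc : 0 < c) (h : c * Fintype.card (𝓞 K ⧸ P.asIdeal ^ n) < 1) :
    Concentrated c ε τ p d₀ μ := by
  classical
  have hn' : (0 : ℝ) < n := by exact_mod_cast hn
  have hq : (0 : ℝ) < Fintype.card (𝓞 K ⧸ P.asIdeal ^ n) := by exact_mod_cast Fintype.card_pos
  obtain ⟨x, -, hx⟩ : ∃ x ∈ Finset.univ, c < μ x := by
    refine Finset.exists_lt_of_sum_lt ?_
    rw [hμ.2, Finset.sum_const, nsmul_eq_mul, Finset.card_univ, mul_comm]
    exact h
  refine ⟨n, le_rfl, mul_lt_of_lt_one_left hn' hε1,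
    Ideal.Quotient.factorPow P.asIdeal le_rfl x, ?_⟩
  calc c * (p : ℝ) ^ (-(2 * d₀ * n * τ / ε)) ≤ c * 1 := by
        gcongr
        refine Real.rpow_le_one_of_one_le_of_nonpos (by exact_mod_cast hp) ?_
        rw [neg_nonpos]
        positivity
    _ < μ x := by rwa [mul_one]
    _ ≤ _ := by
        refine Finset.single_le_sum (f := μ) (fun y _ => hμ.1 y) ?_
        exact Finset.mem_filter.2 ⟨Finset.mem_univ x, rfl⟩

open Classical in
/-- The sum-product set in a finite ring with a distinguished element `ω` and sets `J m`
playing the roles of a uniformizer and of the multiples of `ω ^ m`. -/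
theorem IsProbability.hasSumProductSet {R : Type*} [CommRing R] [Fintype R]
    {μ : R → ℝ} (hμ : IsProbability μ) {ω : R} {n : ℕ} (hn0 : (0 : ℝ) < n) {a q ε τ c : ℝ}
    (ha2 : 2 ≤ a) (hqa : q = a ^ n) (hq : q = Fintype.card R)
    (hfib : ∀ k z, ((Finset.univ.filter fun x => ω ^ k * x = z).card : ℝ) ≤ a ^ k)
    (J : ℕ → Finset R) (hval : ∀ m ≤ n, ∀ x ∉ J m, ∃ k < m, ∃ u : Rˣ, x = ω ^ k * u)
    (hmass : ∀ m ≤ n, ∀ s : ℝ, 1 ≤ s → s * (ε * n) < m →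
      mass μ (J m) ≤ c * q ^ (-(2 * s * τ)) ∧ mass (autoConv μ) (J m) ≤ c * q ^ (-(2 * s * τ)))
    (hτ : 0 < τ) (hτε : τ < ε) (hε1 : ε < 1 / 2) (hq1 : 1 ≤ q) (hq2 : 4096 ≤ q ^ ε)
    (hq3 : 32 ≤ q ^ (ε - τ)) (hq4 : 32 * c ≤ q ^ τ)
    (hq5 : ∀ n : ℕ, (2 : ℝ) ^ n ≤ q → (n : ℝ) ^ 2 ≤ q ^ ε) (hFD : ¬ FourierDecay τ μ) :
    HasSumProductSet 1600 ε n ω μ := by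
  have hε : 0 < ε := hτ.trans hτε
  have hq0 : 0 < q := by linarith
  have ha1 : 1 ≤ a := by linarith
  have hκ := hμ.autoConv_zero_pos
  set h := q ^ ε with hh
  have hh0 : 0 < h := by linarith
  have hh1 : 1 ≤ h := by linarith
  have hpow : ∀ i : ℕ, q ^ (i * ε) = h ^ i := fun i => by
    rw [mul_comm, Real.rpow_mul hq0.le, Real.rpow_natCast]
  set α := q ^ (-τ) with hα
  have hα0 : 0 < α := by positivity
  have hαh : h * α = q ^ (ε - τ) := by
    rw [hh, hα, ← Real.rpow_add hq0, sub_eq_add_neg]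
  have hαh2 : (32 : ℝ) ^ 2 ≤ (h * α) ^ 2 := by rw [hαh]; gcongr
  have hατ : α * q ^ τ = 1 := by rw [hα, ← Real.rpow_add hq0, neg_add_cancel, Real.rpow_zero]
  have hcα : c * α ≤ 1 / 32 := by
    have := mul_le_mul_of_nonneg_left hq4 hα0.le
    linarith
  have hfib' : ∀ (k : ℕ) (s : ℝ), (k : ℝ) ≤ s * n → ∀ z,
      ((Finset.univ.filter fun x => ω ^ k * x = z).card : ℝ) ≤ q ^ s :=
    fun k s hks z => (hfib k z).trans (mul_pow_le_rpow_of_le ha1 hqa hks)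
  have hfibu : ∀ (k : ℕ) (s : ℝ), (k : ℝ) ≤ s * n → ∀ (u : Rˣ) z,
      ((Finset.univ.filter fun x => x * (ω ^ k * u) = z).card : ℝ) ≤ q ^ s := by
    intro k s hks u z
    have : (Finset.univ.filter fun x => x * (ω ^ k * u) = z)
        = Finset.univ.filter fun x => ω ^ k * x = z * (u⁻¹ : Rˣ) := by
      ext x
      rw [Finset.mem_filter, Finset.mem_filter, Units.eq_mul_inv_iff_mul_eq, ← mul_assoc,
        mul_comm x]
    rw [this]
    exact hfib' k s hks _
  have hlevel : ∀ s : ℝ, 1 ≤ s → s * ε < 1 → ⌊s * (ε * n)⌋₊ + 1 ≤ n := by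
    intro s hs hs1
    refine Nat.succ_le_of_lt ((Nat.floor_lt (by positivity)).2 ?_)
    rw [← mul_assoc]
    exact mul_lt_of_lt_one_left hn0 hs1
  have hm₀ := hlevel 1 le_rfl (by linarith)
  have hm₁ := hlevel (3 / 2) (by norm_num) (by linarith)
  set m₀ := ⌊1 * (ε * n)⌋₊ + 1 with hm₀def
  set m₁ := ⌊3 / 2 * (ε * n)⌋₊ + 1 with hm₁def
  have hlt₀ : 1 * (ε * n) < m₀ := by exact_mod_cast Nat.lt_floor_add_one _
  have hlt₁ : 3 / 2 * (ε * n) < m₁ := by exact_mod_cast Nat.lt_floor_add_one _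
  have hfl₀ : ∀ k < m₀, (k : ℝ) ≤ ε * n := fun k hk => by
    have := Nat.le_of_lt_succ hk
    have := (Nat.le_floor_iff (by positivity)).1 this
    linarith
  have hfl₁ : ∀ k < m₁, (k : ℝ) ≤ 3 / 2 * (ε * n) := fun k hk =>
    (Nat.le_floor_iff (by positivity)).1 (Nat.le_of_lt_succ hk)
  have hα1 : q ^ (-(2 * 1 * τ)) = α * α := by rw [hα, ← Real.rpow_add hq0]; congr 1; ring
  have hα2 : q ^ (-(2 * (3 / 2) * τ)) = α * α ^ 2 := by
    rw [sq, hα, ← Real.rpow_add hq0, ← Real.rpow_add hq0]; congr 1; ring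
  have hstart := le_of_not_fourierDecay hFD
  rw [← hq] at hstart
  have hstep := hμ.sum_level_autoConv_ge (θ := (h ^ 2)⁻¹) (F := h) hα0 (by positivity)
    (by
      have : (h ^ 2)⁻¹ * h = h⁻¹ := by field_simp
      rw [this, inv_le_iff_one_le_mul₀ hh0]
      linarith)
    (J m₀) ((hmass m₀ hm₀ 1 le_rfl hlt₀).1.trans (by
      rw [hα1, ← mul_assoc]
      exact (mul_le_mul_of_nonneg_right hcα hα0.le).trans (by linarith)))
    (fun y hy => by
      obtain ⟨k, hk, u, rfl⟩ := hval m₀ hm₀ y hy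
      exact hfibu k ε (hfl₀ k hk) u) hstart
  have hq2' : q ^ (2 * ε) = h ^ 2 := by exact_mod_cast hpow 2
  have hcount := hμ.card_mul_mem_level_ge (β := α ^ 2 / 4) (θ := (h ^ 4)⁻¹) (F := h ^ 2)
    (by positivity) (by positivity) (one_le_pow₀ hh1)
    (by
      have : (h ^ 4)⁻¹ * h ^ 2 = (h ^ 2)⁻¹ := by field_simp
      rw [this, inv_le_iff_one_le_mul₀ (by positivity)]
      linarith)
    _ (J m₁) ((hmass m₁ hm₁ (3 / 2) (by norm_num) hlt₁).2.trans (by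
      rw [hα2, ← mul_assoc]
      exact (mul_le_mul_of_nonneg_right hcα (sq_nonneg α)).trans (by linarith)))
    (fun y hy => by
      obtain ⟨k, hk, u, rfl⟩ := hval m₁ hm₁ y hy
      rw [← hq2']
      exact hfibu k (2 * ε) (by linarith [hfl₁ k hk, mul_pos hε hn0]) u) hstep
  obtain ⟨S, k, hk, hS1, hS2, hS3, hS4, hS5⟩ := hμ.exists_sumProduct_set (m := m₁) (ω := ω)
    (Nat.succ_pos _) hq2
    (by
      have : (m₁ : ℝ) ≤ n := by exact_mod_cast hm₁
      refine le_trans (by gcongr) (hq5 n ?_)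
      rw [hqa]
      gcongr)
    (fun k hk => by
      rw [← hpow 4]
      refine hfib' k _ ?_
      have h1 : k ≤ 2 * (m₁ - 1) := by omega
      have h2 := hfl₁ (m₁ - 1) (by omega)
      have h3 : (k : ℝ) ≤ 2 * ((m₁ - 1 : ℕ) : ℝ) := by exact_mod_cast h1
      push_cast at *
      linarith [mul_pos hε hn0])
    (fun k hk => by
      rw [← hq2']
      exact hfib' k _ (by linarith [hfl₁ k hk, mul_pos hε hn0]))
    (J m₁) (hval m₁ hm₁) (by
      refine le_trans ?_ (hcount.trans ?_)
      · gcongr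
        rw [inv_le_iff_one_le_mul₀ (by positivity)]
        have : (h * α) ^ 2 ≤ h * (h * α) ^ 2 := le_mul_of_one_le_left (by positivity) hh1
        linarith
      · norm_cast
        refine Finset.card_le_card fun z hz => ?_
        simpa [and_assoc] using hz)
  have hpowC : q ^ (1600 * ε) = h ^ 1600 := by exact_mod_cast hpow 1600
  have hSne : (S.image (ω ^ k * ·)).Nonempty := by
    rw [Finset.nonempty_iff_ne_empty]
    intro h0
    rw [h0] at hS5
    have : (0 : ℝ) < (h ^ 1600)⁻¹ := by positivity
    simp only [mass, Finset.sum_empty] at hS5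
    linarith
  refine ⟨S, hS1, ?_, ?_, k, ?_, hS3, ?_, ?_⟩
  · rw [fourierEnergy_eq, phi, ← hq, Real.rpow_add hq0, Real.rpow_one, hq2']
    have h1 : (S.card : ℝ) * ((h ^ 2)⁻¹ * autoConv μ 0) < 1 := by
      rw [← hS3, ← nsmul_eq_mul, ← Finset.sum_const]
      exact (Finset.sum_lt_sum_of_nonempty hSne hS4).trans_le
        (hμ.isProbability_autoConv.mass_le_one _)
    have h2 : (S.card : ℝ) * (q * autoConv μ 0)
        = q * h ^ 2 * (S.card * ((h ^ 2)⁻¹ * autoConv μ 0)) := by field_simp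
    calc (S.card : ℝ) * (q * autoConv μ 0) = _ := h2
      _ < q * h ^ 2 * 1 := by gcongr
      _ = q * h ^ 2 := mul_one _
  · rw [← hq, hpowC]
    exact hS2
  · linarith [hfl₁ k hk, mul_pos hε hn0]
  · intro x hx
    rw [phi, phi, ← hq, Real.rpow_neg hq0.le, hq2', mul_left_comm]
    exact mul_lt_mul_of_pos_left (hS4 x hx) hq0
  · rw [← hq, Real.rpow_neg hq0.le, hpowC]
    exact hS5

/-- The trichotomy for `q` above the threshold. -/
theorem trichotomy_of_threshold {ε τ c : ℝ} (hc : 0 < c) (hτ : 0 < τ) (hτε : τ < ε)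
    (hε1 : ε < 1 / 2) {K : Type*} [Field K] [NumberField K] (P : HeightOneSpectrum (𝓞 K))
    (n p d₀ : ℕ) (ϖ : 𝓞 K) (μ : 𝓞 K ⧸ P.asIdeal ^ n → ℝ) (hn : 1 ≤ n) (hp : p.Prime)
    (hcard : Nat.card (𝓞 K ⧸ P.asIdeal) = p ^ d₀) (hϖ1 : ϖ ∈ P.asIdeal) (hϖ2 : ϖ ∉ P.asIdeal ^ 2)
    (hμ : IsProbability μ) {q : ℝ} (hq : q = Fintype.card (𝓞 K ⧸ P.asIdeal ^ n))
    (hq1 : 1 ≤ q) (hq2 : 4096 ≤ q ^ ε) (hq3 : 32 ≤ q ^ (ε - τ)) (hq4 : 32 * c ≤ q ^ τ)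
    (hq5 : ∀ n : ℕ, (2 : ℝ) ^ n ≤ q → (n : ℝ) ^ 2 ≤ q ^ ε) :
    FourierDecay τ μ ∨ Concentrated c ε τ p d₀ μ ∨
      HasSumProductSet 1600 ε n (Ideal.Quotient.mk (P.asIdeal ^ n) ϖ) μ := by
  classical
  by_contra! hcon
  obtain ⟨hFD, hconc, hSP⟩ := hcon
  refine hSP ?_
  have hε : 0 < ε := hτ.trans hτε
  have hn0 : (0 : ℝ) < n := by exact_mod_cast hn
  have hfin : ∀ n, Finite (𝓞 K ⧸ P.asIdeal ^ n) := fun n => inferInstance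
  have hqa : q = ((p : ℝ) ^ d₀) ^ n := by
    rw [hq, ← Nat.card_eq_fintype_card, card_quotient_pow, hcard]
    push_cast
    rfl
  have hcard2 : 2 ≤ Nat.card (𝓞 K ⧸ P.asIdeal) := by
    have : Finite (𝓞 K ⧸ P.asIdeal) := by
      have := hfin 1
      rwa [pow_one] at this
    have : Nontrivial (𝓞 K ⧸ P.asIdeal) := Ideal.Quotient.nontrivial_iff.2 P.isPrime.ne_top
    exact Finite.one_lt_card
  have ha2 : (2 : ℝ) ≤ (p : ℝ) ^ d₀ := by
    rw [hcard] at hcard2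
    exact_mod_cast hcard2
  refine hμ.hasSumProductSet hn0 ha2 hqa hq (c := c) (fun k z => ?_)
    (fun m => if hm : m ≤ n then
      Finset.univ.filter fun x => Ideal.Quotient.factorPow P.asIdeal hm x = 0 else ∅)
    (fun m hm x hx => ?_) (fun m hm s hs hsm => ?_) hτ hτε hε1 hq1 hq2 hq3 hq4 hq5 hFD
  · have := card_fiber_pow_mul_le P hϖ1 hϖ2 n k z
    rw [hcard] at this
    exact_mod_cast this
  · rw [dif_pos hm, Finset.mem_filter, not_and] at hx
    exact exists_eq_pow_mul_unit P hϖ1 hϖ2 hm (hx (Finset.mem_univ x))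
  · have hεm : ε * n < m := lt_of_le_of_lt (le_mul_of_one_le_left (by positivity) hs) hsm
    have hmass : ∀ y,
        mass μ (Finset.univ.filter fun x => Ideal.Quotient.factorPow P.asIdeal hm x = y)
          ≤ c * q ^ (-(2 * s * τ)) := by
      intro y
      by_contra! hlt
      refine hconc ⟨m, hm, hεm, y, lt_of_le_of_lt ?_ hlt⟩
      gcongr
      exact rpow_neg_le_rpow_neg hp.one_lt.le hqa hε hτ hsm.le
    rw [dif_pos hm]
    exact ⟨hmass 0, hμ.mass_autoConv_ker_le _ hmass⟩

end SumProduct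

theorem proposition3p1 :
    ∃ C : ℝ, 0 < C ∧ ∃ ε₀ : ℝ, 0 < ε₀ ∧ ∀ ε τ : ℝ, 0 < τ → τ < ε → ε < ε₀ →
      (∃ c : ℝ, 0 < c ∧ SumProduct.TrichotomyFrom.{u} C c ε τ 0) ∧
      (∀ c : ℝ, 0 < c → ∃ N : ℕ, SumProduct.TrichotomyFrom.{u} C c ε τ N) := by
  refine ⟨1600, by norm_num, 1 / 2, by norm_num, fun ε τ hτ hτε hε => ?_⟩
  have hlarge : ∀ c : ℝ, 0 < c → ∃ N : ℕ, SumProduct.TrichotomyFrom.{u} 1600 c ε τ N := by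
    intro c hc
    obtain ⟨N, hN⟩ := SumProduct.exists_threshold (c := c) hτ hτε
    refine ⟨N, fun K _ _ P n p d₀ ϖ μ hn hp hcard hNq hϖ1 hϖ2 hμ => ?_⟩
    obtain ⟨h1, h2, h3, h4, h5⟩ := hN _ (Nat.cast_le.2 hNq)
    exact SumProduct.trichotomy_of_threshold hc hτ hτε hε P n p d₀ ϖ μ hn hp hcard hϖ1 hϖ2 hμ rfl
      h1 h2 h3 h4 h5
  refine ⟨?_, hlarge⟩
  obtain ⟨N, hN⟩ := hlarge 1 one_pos
  refine ⟨1 / (N + 1), by positivity,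
    fun K _ _ P n p d₀ ϖ μ hn hp hcard _ hϖ1 hϖ2 hμ => ?_⟩
  rcases le_or_gt N (Fintype.card (𝓞 K ⧸ P.asIdeal ^ n)) with hle | hlt
  · rcases hN K P n p d₀ ϖ μ hn hp hcard hle hϖ1 hϖ2 hμ with h | h | h
    · exact Or.inl h
    · refine Or.inr (Or.inl (h.mono ?_))
      rw [div_le_one (by positivity)]
      linarith [Nat.cast_nonneg (α := ℝ) N]
    · exact Or.inr (Or.inr h)
  · refine Or.inr (Or.inl (SumProduct.concentrated_of_mul_card_lt hμ hn (hτ.trans hτε)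
      (by linarith) hτ hp.one_lt.le (by positivity) ?_))
    rw [one_div, inv_mul_lt_iff₀ (by positivity), mul_one]
    exact_mod_cast hlt.trans (Nat.lt_succ_self N)
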